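/- Let $K$ be a number field, $G$ a finite group and $Y$ a $K$-variety (an integral separated scheme of finite type over $K$) with a faithful left action of $G$ by $K$-automorphisms. Suppose that the quotient $\pi\colon Y\to X=Y/G$ exists as a $K$-scheme, i.e. $\pi$ is an affine $G$-invariant $K$-morphism with $\mathcal O_X=(\pi_*\mathcal O_Y)^G$. For a subgroup $H\le G$ let $Y/H=\operatorname{Spec}_X\,(\pi_*\mathcal O_Y)^H$ be the quotient by $H$, with its natural morphism to $X$. Let $Y^\circ\subset Y$ and $X^\circ\subset X$ be the largest open subschemes on which, respectively over which, $\pi$ is unramified, and let $Y^\circ/H$ be the open part of $Y/H$ over $X^\circ$. A large $G$-field is a Galois extension $L/K$ with an isomorphism $\mathrm{Gal}(L/K)\cong G$; two are isomorphic if there is a $G$-equivariant $K$-isomorphism between them. Let $G\text{-}\mathrm{Fie}(K)$ be the set of isomorphism classes, each with a chosen representative $L$. Let $g\in G$ act on $\operatorname{Spec}L$ on the left (through $g^{-1}$ acting on $L$), and let $Y(L)^G$ be the set of $G$-equivariant $K$-morphisms $y\colon\operatorname{Spec}L\to Y$. Put $$Y\{K\}=\bigsqcup_{L\in G\text{-}\mathrm{Fie}(K)}Y(L)^G/Z(G),$$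 where the centre $Z(G)$ acts through its action on $\operatorname{Spec} L$, and let $Y^\circ\{K\}\subset Y\{K\}$ be the subset of classes of points that factor through $Y^\circ$. Let $\pi_*\colon Y\{K\}\to X(K)$ send the class of $y$ to the unique $K$-point $x$ such that $\operatorname{Spec}L\to\operatorname{Spec}K\xrightarrow{x}X$ equals $\pi\circ y$. Finally, define the set of primitive $K$-points of $X$ by $$X(K)^{\mathrm{prim}}=X^\circ(K)\setminus\bigcup_{H\subsetneq G}\mathrm{Im}\big((Y^\circ/H)(K)\to X^\circ(K)\big).$$ Then $\pi_*$ restricts to a bijection $Y^\circ\{K\}\to X(K)^{\mathrm{prim}}$. -/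

import Mathlib

open CategoryTheory AlgebraicGeometry Limits

universe u v

noncomputable section

namespace GaloisCover

/-- The scheme `Spec K`. -/
abbrev base (K : Type u) [Field K] : Scheme.{u} := Spec (CommRingCat.of K)

section Schemes

variable {K : Type u} [Field K]

/-- A `K`-variety: an integral separated scheme of finite type over `K`. -/
structure IsVariety (Y : Over (base K)) : Prop where
  isIntegral : IsIntegral Y.left
  isSeparated : IsSeparated Y.hom
  locallyOfFiniteType : LocallyOfFiniteType Y.hom
  quasiCompact : QuasiCompact Y.hom

/-- `Spec K` as a `K`-scheme. -/
abbrev pt (K : Type u) [Field K] : Over (base K) := Over.mk (𝟙 (base K))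

/-- `Spec L` as a `K`-scheme, for an extension `L/K`. -/
abbrev specOver (K L : Type u) [Field K] [Field L] [Algebra K L] : Over (base K) :=
  Over.mk (Spec.map (CommRingCat.ofHom (algebraMap K L)))

/-- The structure morphism `Spec L ⟶ Spec K`. -/
abbrev toPt (K L : Type u) [Field K] [Field L] [Algebra K L] : specOver K L ⟶ pt K :=
  Over.homMk (Spec.map (CommRingCat.ofHom (algebraMap K L)))

/-- The automorphism `Spec σ` of `Spec L` induced by `σ ∈ Gal(L/K)`. -/
abbrev specAut {K L : Type u} [Field K] [Field L] [Algebra K L] (σ : L ≃ₐ[K] L) :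
    specOver K L ⟶ specOver K L :=
  Over.homMk (Spec.map (CommRingCat.ofHom (σ : L →+* L))) (by
    simp only [Over.mk_left, Over.mk_hom, ← Spec.map_comp, ← CommRingCat.ofHom_comp]
    congr 2
    ext x
    simp)

/-- An open subscheme, as a `K`-scheme. -/
abbrev openSub (X : Over (base K)) (U : X.left.Opens) : Over (base K) := Over.mk (U.ι ≫ X.hom)

/-- The inclusion of an open subscheme. -/
abbrev openIncl (X : Over (base K)) (U : X.left.Opens) : openSub X U ⟶ X := Over.homMk U.ι

variable {G : Type v} [Group G] {Y X : Over (base K)}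

/-- The subring `Γ(π⁻¹ U, 𝒪_Y)ᴴ` of `H`-invariant functions on `π⁻¹ U`. (If `π` is `G`-invariant
then `π⁻¹ U` is `G`-stable, and `e` below always holds.) -/
def invariantSections (ρ : G →* Aut Y) (π : Y ⟶ X) (H : Subgroup G) (U : X.left.Opens) :
    Subring Γ(Y.left, π.left ⁻¹ᵁ U) where
  carrier := {s | ∀ h ∈ H, ∀ e : π.left ⁻¹ᵁ U ≤ (ρ h).hom.left ⁻¹ᵁ (π.left ⁻¹ᵁ U),
    (ρ h).hom.left.appLE (π.left ⁻¹ᵁ U) (π.left ⁻¹ᵁ U) e s = s}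
  mul_mem' ha hb h hh e := by rw [map_mul, ha h hh e, hb h hh e]
  one_mem' h hh e := map_one _
  add_mem' ha hb h hh e := by rw [map_add, ha h hh e, hb h hh e]
  zero_mem' h hh e := map_zero _
  neg_mem' ha h hh e := by rw [map_neg, ha h hh e]

/-- `π : Y ⟶ X` is the quotient of `Y` by the action `ρ` of the finite group `G`, i.e. `X = Y/G`:
`π` is affine and `G`-invariant, and `𝒪_X = (π_* 𝒪_Y)ᴳ`. -/
structure IsQuotient (ρ : G →* Aut Y) (π : Y ⟶ X) : Prop where
  isAffineHom : IsAffineHom π.left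
  invariant : ∀ g : G, (ρ g).hom ≫ π = π
  injective : ∀ U : X.left.Opens, Function.Injective (π.left.app U)
  range_eq : ∀ U : X.left.Opens,
    (π.left.app U).hom.range = invariantSections ρ π ⊤ U

section IntermediateQuotient

variable {ρ : G →* Aut Y} {π : Y ⟶ X}

lemma preimage_eq (hinv : ∀ g : G, (ρ g).hom ≫ π = π) (g : G) (U : X.left.Opens) :
    (ρ g).hom.left ⁻¹ᵁ (π.left ⁻¹ᵁ U) = π.left ⁻¹ᵁ U := by
  rw [← Scheme.Hom.comp_preimage, ← Over.comp_left, hinv g]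

lemma res_mem (hinv : ∀ g : G, (ρ g).hom ≫ π = π) (H : Subgroup G) {U V : X.left.Opens}
    (i : V ≤ U) {s : Γ(Y.left, π.left ⁻¹ᵁ U)} (hs : s ∈ invariantSections ρ π H U) :
    Y.left.presheaf.map (homOfLE (π.left.preimage_mono i)).op s ∈ invariantSections ρ π H V := by
  intro h hh e
  have h1 := hs h hh (preimage_eq hinv h U).ge
  conv_rhs => rw [← h1]
  rw [← CommRingCat.comp_apply, ← CommRingCat.comp_apply, Scheme.Hom.map_appLE,
    Scheme.Hom.appLE_map]

lemma app_mem (hinv : ∀ g : G, (ρ g).hom ≫ π = π) (H : Subgroup G) (U : X.left.Opens)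
    (s : Γ(X.left, U)) : π.left.app U s ∈ invariantSections ρ π H U := by
  intro h hh e
  rw [Scheme.Hom.app_eq_appLE, ← CommRingCat.comp_apply, Scheme.Hom.appLE_comp_appLE]
  have h2 : (ρ h).hom.left ≫ π.left = π.left := by rw [← Over.comp_left, hinv h]
  congr 2
  simp only [h2]

/-- The sheaf of `𝒪_X`-algebras `(π_* 𝒪_Y)ᴴ`. -/
def invariantsDiagram (hinv : ∀ g : G, (ρ g).hom ≫ π = π) (H : Subgroup G) :
    X.left.Opensᵒᵖ ⥤ CommRingCat.{u} where
  obj U := .of (invariantSections ρ π H U.unop)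
  map {U V} i := CommRingCat.ofHom
    ((Y.left.presheaf.map (homOfLE (π.left.preimage_mono i.unop.le)).op).hom.restrict _ _
      fun _ hx => res_mem hinv H i.unop.le hx)
  map_id U := by
    ext x
    change Y.left.presheaf.map _ x.1 = x.1
    simp
  map_comp i j := by
    ext x
    change Y.left.presheaf.map _ x.1 = Y.left.presheaf.map _ (Y.left.presheaf.map _ x.1)
    rw [← CommRingCat.comp_apply, ← Functor.map_comp]
    rfl

/-- The structure map `𝒪_X ⟶ (π_* 𝒪_Y)ᴴ`. -/
def invariantsMap (hinv : ∀ g : G, (ρ g).hom ≫ π = π) (H : Subgroup G) :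
    X.left.presheaf ⟶ invariantsDiagram hinv H where
  app U := CommRingCat.ofHom ((π.left.app U.unop).hom.codRestrict _ (app_mem hinv H U.unop))
  naturality {U V} i := by
    ext x
    exact Subtype.ext congr($(π.left.naturality i) x)

/-- `Γ(π⁻¹ D(r), 𝒪_Y)` is the localization of `Γ(π⁻¹ U, 𝒪_Y)` at `r`. -/
lemma away_res [IsAffineHom π.left] {U : X.left.Opens} (hU : IsAffineOpen U) (r : Γ(X.left, U)) :
    let := (Y.left.presheaf.map
      (homOfLE (π.left.preimage_mono (X.left.basicOpen_le r))).op).hom.toAlgebra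
    IsLocalization.Away (π.left.app U r) Γ(Y.left, π.left ⁻¹ᵁ X.left.basicOpen r) := by
  have key : ∀ (V : Y.left.Opens) (i : V ≤ π.left ⁻¹ᵁ U)
      (_ : V = Y.left.basicOpen (π.left.app U r)),
      let := (Y.left.presheaf.map (homOfLE i).op).hom.toAlgebra
      IsLocalization.Away (π.left.app U r) Γ(Y.left, V) := by
    rintro V i rfl
    exact (hU.preimage π.left).isLocalization_basicOpen (π.left.app U r)
  exact key _ _ (π.left.preimage_basicOpen r)

open Scheme.AffineZariskiSite in
/-- The `𝒪_X`-algebra `(π_* 𝒪_Y)ᴴ` is quasi-coherent. -/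
lemma coequifibered_invariantsMap [Finite G] [IsAffineHom π.left]
    (hinv : ∀ g : G, (ρ g).hom ≫ π = π) (H : Subgroup G) :
    ((toOpensFunctor X.left).op.whiskerLeft (invariantsMap hinv H)).Coequifibered := by
  refine coequifibered_iff_forall_isLocalizationAway.mpr fun U r ↦ ?_
  have hle : X.left.basicOpen r ≤ U.1 := X.left.basicOpen_le r
  let res := (Y.left.presheaf.map (homOfLE (π.left.preimage_mono hle)).op).hom
  let r' : Γ(Y.left, π.left ⁻¹ᵁ U.1) := π.left.app U.1 r
  have hr' : r' ∈ invariantSections ρ π H U.1 := app_mem hinv H U.1 r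
  have hloc := away_res (π := π) U.2 r
  have hunit : IsUnit (⟨res r', res_mem hinv H hle hr'⟩ :
      invariantSections ρ π H (X.left.basicOpen r)) := by
    have h1 : IsUnit ((X.left.presheaf.map (homOfLE hle).op).hom r) :=
      X.left.toRingedSpace.isUnit_res_basicOpen r
    convert! h1.map ((π.left.app (X.left.basicOpen r)).hom.codRestrict _ (app_mem hinv H _)) using 1
    exact Subtype.ext congr($(π.left.naturality (homOfLE hle).op) r).symm
  have hsurj : ∀ z, ∃ (n : ℕ) (a : Γ(Y.left, π.left ⁻¹ᵁ U.1)), z * res r' ^ n = res a := by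
    let := res.toAlgebra
    exact fun z => IsLocalization.Away.surj r' z
  have heq : ∀ a b, res a = res b → ∃ n : ℕ, r' ^ n * a = r' ^ n * b := by
    let := res.toAlgebra
    exact fun a b h => IsLocalization.Away.exists_of_eq r' h
  let alg : Algebra (invariantSections ρ π H U.1)
      (invariantSections ρ π H (X.left.basicOpen r)) :=
    (res.restrict _ _ fun _ hx => res_mem hinv H hle hx).toAlgebra
  change IsLocalization.Away (⟨r', hr'⟩ : invariantSections ρ π H U.1)
    (invariantSections ρ π H (X.left.basicOpen r))
  refine IsLocalization.Away.mk _ hunit ?_ ?_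
  · rintro ⟨z, hz⟩
    obtain ⟨n, a, hna⟩ := hsurj z
    let act (h : H) : Γ(Y.left, π.left ⁻¹ᵁ U.1) →+* Γ(Y.left, π.left ⁻¹ᵁ U.1) :=
      ((ρ h).hom.left.appLE _ _ (preimage_eq hinv h U.1).ge).hom
    have hact (h : H) : res (act h a) = res a := by
      have h1 : z * res r' ^ n ∈ invariantSections ρ π H (X.left.basicOpen r) :=
        Subring.mul_mem _ hz (Subring.pow_mem _ (res_mem hinv H hle hr') n)
      have h2 := h1 h h.2 (preimage_eq hinv h _).ge
      rw [hna] at h2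
      conv_rhs => rw [← h2]
      have e1 : (ρ h).hom.left.appLE _ _ (preimage_eq hinv h U.1).ge ≫
          Y.left.presheaf.map (homOfLE (π.left.preimage_mono hle)).op =
          Y.left.presheaf.map (homOfLE (π.left.preimage_mono hle)).op ≫
            (ρ h).hom.left.appLE _ _ (preimage_eq hinv h (X.left.basicOpen r)).ge := by
        rw [Scheme.Hom.map_appLE, Scheme.Hom.appLE_map]
      exact congr($e1 a)
    choose m hm using fun h : H => heq _ _ (hact h)
    have := Fintype.ofFinite H
    let M := ∑ h : H, m h
    refine ⟨M + n, ⟨r' ^ M * a, ?_⟩, Subtype.ext ?_⟩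
    · intro h hh e
      have h3 : r' ^ M * act ⟨h, hh⟩ a = r' ^ M * a := by
        obtain ⟨k, hk⟩ := Nat.exists_eq_add_of_le
          (Finset.single_le_sum (f := m) (fun _ _ => Nat.zero_le _) (Finset.mem_univ ⟨h, hh⟩))
        have hk' : M = k + m ⟨h, hh⟩ := by rw [add_comm]; exact hk
        rw [hk', pow_add, mul_assoc, hm, mul_assoc]
      rw [map_mul, map_pow, hr' h hh e]
      exact h3
    · change z * res r' ^ (M + n) = res (r' ^ M * a)
      rw [map_mul, map_pow, ← hna, pow_add]
      ring
  · rintro ⟨a, ha⟩ ⟨b, hb⟩ h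
    obtain ⟨n, hn⟩ := heq a b congr(Subtype.val $h)
    exact ⟨n, Subtype.ext hn⟩

/-- The gluing datum for the relative spectrum of `(π_* 𝒪_Y)ᴴ` over `X`. -/
def interData [Finite G] [IsAffineHom π.left] (hinv : ∀ g : G, (ρ g).hom ≫ π = π)
    (H : Subgroup G) :=
  Scheme.AffineZariskiSite.relativeGluingData (coequifibered_invariantsMap hinv H)

/-- The quotient `Y/H`, constructed as the relative spectrum of the `𝒪_X`-algebra
`(π_* 𝒪_Y)ᴴ`: it is glued from the affine schemes `Spec (Γ(π⁻¹ U, 𝒪_Y)ᴴ)` with `U ⊆ X` affine. -/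
def interQuotient [Finite G] (hπ : IsQuotient ρ π) (H : Subgroup G) : Over (base K) :=
  haveI := hπ.isAffineHom
  Over.mk ((interData hπ.invariant H).toBase ≫ X.hom)

/-- The natural morphism `Y/H ⟶ X = Y/G`. -/
def interQuotientMap [Finite G] (hπ : IsQuotient ρ π) (H : Subgroup G) :
    interQuotient hπ H ⟶ X :=
  haveI := hπ.isAffineHom
  Over.homMk (interData hπ.invariant H).toBase

end IntermediateQuotient

/-- `X°`: the largest open subset of `X` over which `π` is unramified. -/
def unramX (π : Y ⟶ X) : X.left.Opens :=
  sSup {U | FormallyUnramified (π.left ∣_ U)}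

/-- `Y°`: the largest open subset of `Y` on which `π` is unramified. -/
def unramY (π : Y ⟶ X) : Y.left.Opens :=
  sSup {V | FormallyUnramified (V.ι ≫ π.left)}

/-- `Y°/H`, as the open subscheme of `Y/H` lying over `X°` (`Y°` is the preimage of `X°`). -/
def unramInterQuotient {ρ : G →* Aut Y} {π : Y ⟶ X} [Finite G] (hπ : IsQuotient ρ π)
    (H : Subgroup G) : Over (base K) :=
  openSub (interQuotient hπ H) ((interQuotientMap hπ H).left ⁻¹ᵁ unramX π)

/-- The morphism `Y°/H ⟶ X`; its image is contained in `X°`. -/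
def unramInterQuotientMap {ρ : G →* Aut Y} {π : Y ⟶ X} [Finite G] (hπ : IsQuotient ρ π)
    (H : Subgroup G) : unramInterQuotient hπ H ⟶ X :=
  openIncl _ _ ≫ interQuotientMap hπ H

/-- The set `X(K)^prim` of primitive `K`-points of `X`:
`X°(K)` minus the images of `(Y°/H)(K)` for all proper subgroups `H` of `G`. -/
def primitivePoints {ρ : G →* Aut Y} {π : Y ⟶ X} [Finite G] (hπ : IsQuotient ρ π) :
    Set (pt K ⟶ X) :=
  Set.range (fun x : pt K ⟶ openSub X (unramX π) => x ≫ openIncl X (unramX π)) \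
    ⋃ (H : Subgroup G) (_ : H < ⊤),
      Set.range (fun z : pt K ⟶ unramInterQuotient hπ H => z ≫ unramInterQuotientMap hπ H)

end Schemes

/-- A large `G`-field over `K`: a Galois extension `L/K` with an isomorphism `Gal(L/K) ≅ G`. -/
structure LargeField (G : Type v) [Group G] (K : Type u) [Field K] where
  carrier : Type u
  [field : Field carrier]
  [algebra : Algebra K carrier]
  [isGalois : IsGalois K carrier]
  iso : (carrier ≃ₐ[K] carrier) ≃* G

attribute [instance] LargeField.field LargeField.algebra LargeField.isGalois

section Points

variable {K : Type u} [Field K] {G : Type v} [Group G]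

/-- Isomorphism of large `G`-fields: a `G`-equivariant `K`-isomorphism `L ≅ L'`. -/
instance largeFieldSetoid (G : Type v) [Group G] (K : Type u) [Field K] :
    Setoid (LargeField.{u, v} G K) where
  r L L' := ∃ e : L.carrier ≃ₐ[K] L'.carrier,
    ∀ (g : G) (a : L.carrier), e (L.iso.symm g a) = L'.iso.symm g (e a)
  iseqv :=
    { refl := fun _ => ⟨AlgEquiv.refl, fun _ _ => rfl⟩
      symm := by
        rintro L L' ⟨e, he⟩
        refine ⟨e.symm, fun g a => ?_⟩
        rw [AlgEquiv.symm_apply_eq, he, AlgEquiv.apply_symm_apply]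
      trans := by
        rintro L L' L'' ⟨e, he⟩ ⟨e', he'⟩
        exact ⟨e.trans e', fun g a => by simp [he, he']⟩ }

/-- The set `G-Fie(K)` of isomorphism classes of large `G`-fields. -/
abbrev LargeFieldClass (G : Type v) [Group G] (K : Type u) [Field K] :=
  Quotient (largeFieldSetoid.{u, v} G K)

/-- The left action of `g ∈ G` on `Spec L` for a large `G`-field `L`: since `G` acts on `L` from
the left, `g` acts on `Spec L` as `Spec` of the action of `g⁻¹` on `L`. -/
def LargeField.act (L : LargeField.{u, v} G K) (g : G) :
    specOver K L.carrier ⟶ specOver K L.carrier :=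
  specAut (L.iso.symm g⁻¹)

lemma LargeField.act_comp (L : LargeField.{u, v} G K) (g h : G) :
    L.act g ≫ L.act h = L.act (h * g) := by
  apply Over.OverMorphism.ext
  simp only [LargeField.act, Over.comp_left, Over.homMk_left, Over.mk_left, ← Spec.map_comp,
    ← CommRingCat.ofHom_comp]
  congr 2
  ext a
  simp

lemma LargeField.act_one (L : LargeField.{u, v} G K) : L.act 1 = 𝟙 _ := by
  apply Over.OverMorphism.ext
  simp only [LargeField.act, Over.id_left, Over.homMk_left, Over.mk_left]
  rw [← Spec.map_id]
  congr 1
  ext a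
  simp

variable {Y X : Over (base K)}

/-- `Y(L)ᴳ`: the `G`-equivariant `L`-points `Spec L ⟶ Y`. -/
def EquivariantPoint (ρ : G →* Aut Y) (L : LargeField.{u, v} G K) :=
  {y : specOver K L.carrier ⟶ Y // ∀ g : G, L.act g ≫ y = y ≫ (ρ g).hom}

/-- Two equivariant points are identified when they differ by the action of an element of the
centre `Z(G)` on `Spec L`. -/
instance centerSetoid (ρ : G →* Aut Y) (L : LargeField.{u, v} G K) :
    Setoid (EquivariantPoint ρ L) where
  r y y' := ∃ z ∈ Subgroup.center G, L.act z ≫ y.1 = y'.1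
  iseqv :=
    { refl := fun y => ⟨1, Subgroup.one_mem _, by rw [LargeField.act_one, Category.id_comp]⟩
      symm := by
        rintro y y' ⟨z, hz, h⟩
        refine ⟨z⁻¹, Subgroup.inv_mem _ hz, ?_⟩
        rw [← h, ← Category.assoc, LargeField.act_comp, mul_inv_cancel, LargeField.act_one,
          Category.id_comp]
      trans := by
        rintro y y' y'' ⟨z, hz, h⟩ ⟨z', hz', h'⟩
        refine ⟨z * z', Subgroup.mul_mem _ hz hz', ?_⟩
        rw [← h', ← h, ← Category.assoc, LargeField.act_comp] }

/-- `Y{K}`: the disjoint union over the isomorphism classes of large `G`-fields `L` of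
`Y(L)ᴳ / Z(G)`, where `L` is a chosen representative of its class. -/
def CurlyPoints (ρ : G →* Aut Y) :=
  Σ c : LargeFieldClass.{u, v} G K, Quotient (centerSetoid ρ c.out)

/-- `Y°{K} ⊆ Y{K}`: the classes of the equivariant points that factor through `Y°`. -/
def unramCurlyPoints (ρ : G →* Aut Y) (π : Y ⟶ X) : Set (CurlyPoints ρ) :=
  {p | ∃ (c : LargeFieldClass.{u, v} G K) (y : EquivariantPoint ρ c.out),
    (∃ y' : specOver K c.out.carrier ⟶ openSub Y (unramY π), y' ≫ openIncl Y (unramY π) = y.1) ∧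
      p = ⟨c, Quotient.mk _ y⟩}

lemma epi_specMap {L : Type u} [Field L] [Algebra K L] :
    Epi (Spec.map (CommRingCat.ofHom (algebraMap K L))) := by
  have : Flat (Spec.map (CommRingCat.ofHom (algebraMap K L))) :=
    Flat.SpecMap_iff.mpr (RingHom.flat_algebraMap_iff.mpr inferInstance)
  have : Surjective (Spec.map (CommRingCat.ofHom (algebraMap K L))) :=
    ⟨fun p => ⟨IsLocalRing.closedPoint L, Subsingleton.elim (α := PrimeSpectrum K) _ _⟩⟩
  exact Flat.epi_of_flat_of_surjective (Spec.map (CommRingCat.ofHom (algebraMap K L)))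

lemma toPt_cancel {L : Type u} [Field L] [Algebra K L] {x x' : pt K ⟶ X}
    (h : toPt K L ≫ x = toPt K L ≫ x') : x = x' := by
  have := epi_specMap (K := K) (L := L)
  apply Over.OverMorphism.ext
  rw [← cancel_epi (Spec.map (CommRingCat.ofHom (algebraMap K L)))]
  exact congr($(h).left)

lemma exists_descent_aux {L : Type u} [Field L] [Algebra K L] [IsGalois K L] {Z : Scheme.{u}}
    (w : Spec (CommRingCat.of L) ⟶ Z)
    (hw : ∀ σ : L ≃ₐ[K] L, Spec.map (CommRingCat.ofHom (σ : L →+* L)) ≫ w = w) :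
    ∃ x : base K ⟶ Z, Spec.map (CommRingCat.ofHom (algebraMap K L)) ≫ x = w := by
  let p : Z := w (IsLocalRing.closedPoint L)
  let φ : Z.residueField p ⟶ .of L := Z.descResidueField (Scheme.stalkClosedPointTo w)
  have hφ : Spec.map φ ≫ Z.fromSpecResidueField p = w :=
    Scheme.descResidueField_stalkClosedPointTo_fromSpecResidueField L Z w
  have hfix : ∀ (σ : L ≃ₐ[K] L) (a), σ (φ a) = φ a := by
    intro σ a
    have h2 : Spec.map (φ ≫ CommRingCat.ofHom (σ : L →+* L)) = Spec.map φ := by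
      rw [← cancel_mono (Z.fromSpecResidueField p), Spec.map_comp, Category.assoc, hφ, hw]
    exact congr($(Spec.map_injective h2) a)
  have hrange : ∀ a, φ.hom a ∈ (algebraMap K L).range := fun a =>
    (InfiniteGalois.mem_range_algebraMap_iff_fixed _).mpr fun σ => hfix σ a
  let e : K ≃+* (algebraMap K L).range :=
    RingEquiv.ofBijective (algebraMap K L).rangeRestrict
      ⟨fun _ _ h => (algebraMap K L).injective congr(Subtype.val $h),
        (algebraMap K L).rangeRestrict_surjective⟩
  let ψ : Z.residueField p ⟶ .of K :=
    CommRingCat.ofHom (e.symm.toRingHom.comp (φ.hom.codRestrict _ hrange))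
  have hψ : ψ ≫ CommRingCat.ofHom (algebraMap K L) = φ := by
    ext a
    exact congr(Subtype.val $(e.apply_symm_apply ⟨φ.hom a, hrange a⟩))
  refine ⟨Spec.map ψ ≫ Z.fromSpecResidueField p, ?_⟩
  rw [← Category.assoc, ← Spec.map_comp, hψ, hφ]

/-- A `G`-invariant morphism `Spec L ⟶ X` descends to the quotient `Spec K = (Spec L)/G`. -/
lemma exists_descent (L : LargeField.{u, v} G K) (w : specOver K L.carrier ⟶ X)
    (hw : ∀ g : G, L.act g ≫ w = w) : ∃ x : pt K ⟶ X, toPt K L.carrier ≫ x = w := by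
  obtain ⟨x, hx⟩ := exists_descent_aux (K := K) (L := L.carrier) w.left fun σ => by
    have := hw (L.iso σ)⁻¹
    rw [LargeField.act, inv_inv, MulEquiv.symm_apply_apply] at this
    exact congr($(this).left)
  refine ⟨Over.homMk x ?_, Over.OverMorphism.ext hx⟩
  have := epi_specMap (K := K) (L := L.carrier)
  rw [← cancel_epi (Spec.map (CommRingCat.ofHom (algebraMap K L.carrier))), ← Category.assoc]
  refine Eq.trans congr($hx ≫ X.hom) ?_
  exact (Over.w w).trans (Category.comp_id _).symm

lemma exists_pushforward {ρ : G →* Aut Y} {π : Y ⟶ X} (hinv : ∀ g : G, (ρ g).hom ≫ π = π)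
    (L : LargeField.{u, v} G K) (y : EquivariantPoint ρ L) :
    ∃ x : pt K ⟶ X, toPt K L.carrier ≫ x = y.1 ≫ π :=
  exists_descent L _ fun g => by
    rw [← Category.assoc, y.2 g, Category.assoc, hinv g]

/-- The `K`-point of `X` induced by an equivariant point `y : Spec L ⟶ Y` on the `G`-quotients of
source and target: the (unique) `x` such that `Spec L ⟶ Spec K ⟶ X` equals `π ∘ y`. -/
def pushforwardPoint {ρ : G →* Aut Y} {π : Y ⟶ X} (hinv : ∀ g : G, (ρ g).hom ≫ π = π)
    (L : LargeField.{u, v} G K) (y : EquivariantPoint ρ L) : pt K ⟶ X :=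
  (exists_pushforward hinv L y).choose

lemma pushforwardPoint_spec {ρ : G →* Aut Y} {π : Y ⟶ X} (hinv : ∀ g : G, (ρ g).hom ≫ π = π)
    (L : LargeField.{u, v} G K) (y : EquivariantPoint ρ L) :
    toPt K L.carrier ≫ pushforwardPoint hinv L y = y.1 ≫ π :=
  (exists_pushforward hinv L y).choose_spec

/-- The map `π_* : Y{K} → X(K)`. -/
def pushforward {ρ : G →* Aut Y} {π : Y ⟶ X} (hπ : IsQuotient ρ π) :
    CurlyPoints ρ → (pt K ⟶ X) :=
  fun p => Quotient.lift (pushforwardPoint hπ.invariant p.1.out) (by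
    rintro y y' ⟨z, hz, h⟩
    apply toPt_cancel (L := p.1.out.carrier)
    have hz' : p.1.out.act z ≫ toPt K p.1.out.carrier = toPt K p.1.out.carrier := by
      apply Over.OverMorphism.ext
      exact Over.w (p.1.out.act z)
    rw [pushforwardPoint_spec, pushforwardPoint_spec, ← h, Category.assoc,
      ← pushforwardPoint_spec hπ.invariant, ← Category.assoc, hz']) p.2

end Points

end GaloisCover

end

/-! The statement is local around a rational point `x` of `X`. On an affine open `U` containing `x`,
put `R = Γ(X, U)` and `S = Γ(Y, π⁻¹ U)`. Then `R` is the ring of `G`-invariants of `S`, and `x` is a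
surjection `ψ : R → K`. An equivariant point above `x` is a ring map `y : S → L` that extends `ψ`
and intertwines `G` with `Gal(L/K)`. Its kernel is a `G`-stable prime. Since `G` permutes
transitively the primes above `ker ψ`, this kernel is the only one.

Unramifiedness enters through inertia (`IsQuotient.eq_one_of_inertia`). If `g` acts trivially modulo
a prime in `Y°`, Krull's intersection theorem makes it trivial on `S`, hence on the integral
separated scheme `Y`, and `g = 1` by faithfulness. So `y` is surjective by Galois theory: `L` is the
residue field of the unique point above `x`.

Injectivity: two points above `x` have the same kernel, hence are related by a `G`-equivariant
isomorphism of fields; an automorphism of `L` that commutes with `G` comes from the centre.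
Primitivity of the image: if `x` lifts to a rational point of `Y/H`, averaging over `H` shows that
the fixed field of `H` in `L` is `K`, so `H = G` (`eq_top_of_rational`). Surjectivity: let `D` be
the decomposition group of a prime above `x`. Its residue field is Galois over `K` and `D` surjects
onto the Galois group, so the invariants of `D` have residues in `K`. This is a rational point of
`Y/D`, and primitivity forces `D = G`. Trivial inertia then gives `Gal(L/K) ≅ G`
(`exists_equivariant`).

Characteristic zero is used to divide by the order of `H` and to make residue extensions separable.
-/

noncomputable section

namespace GaloisCover

/-! ### Commutative algebra: inertia and decomposition groups -/

section Algebra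

open scoped Pointwise

/-- An endomorphism of a Noetherian domain over `R` which acts trivially on the residue field of a
prime at which the domain is unramified over `R` is trivial. -/
theorem algHom_apply_eq_of_sub_mem {R S T : Type*} [CommRing R] [CommRing S] [CommRing T]
    [Algebra R S] [Algebra S T] [Algebra R T] [IsScalarTower R S T]
    [IsNoetherianRing S] [IsDomain S] [Algebra.FormallyUnramified R T]
    (p : Ideal S) [p.IsPrime] {f : S} [IsLocalization.Away f T] (hf : f ∉ p)
    (σ : S →ₐ[R] S) (hσ : ∀ s, σ s - s ∈ p) (s : S) : σ s = s := by
  let B := Localization.AtPrime p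
  let m := IsLocalRing.maximalIdeal B
  have hunit : ∀ a ∉ p, IsUnit (algebraMap S B a) := fun a ha =>
    IsLocalization.map_units B (⟨a, ha⟩ : p.primeCompl)
  -- This lets both the localization map `S → B` and its composite with `σ` extend to `T`.
  have hσf : σ f ∉ p := fun h => hf ((p.sub_mem_iff_right h).mp (hσ f))
  let g₁ : T →+* B := IsLocalization.Away.lift (g := algebraMap S B) f (hunit f hf)
  let g₂ : T →+* B := IsLocalization.Away.lift (g := (algebraMap S B).comp (σ : S →+* S)) f
    (hunit _ hσf)
  have h₁ : ∀ a, g₁ (algebraMap S T a) = algebraMap S B a := fun a =>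
    IsLocalization.Away.lift_eq f _ a
  have h₂ : ∀ a, g₂ (algebraMap S T a) = algebraMap S B (σ a) := fun a =>
    IsLocalization.Away.lift_eq f _ a
  let G₁ : T →ₐ[R] B := { g₁ with
    commutes' := fun r => by
      simp only [RingHom.toMonoidHom_eq_coe, OneHom.toFun_eq_coe, MonoidHom.toOneHom_coe,
        MonoidHom.coe_coe]
      rw [IsScalarTower.algebraMap_apply R S T, h₁, ← IsScalarTower.algebraMap_apply] }
  let G₂ : T →ₐ[R] B := { g₂ with
    commutes' := fun r => by
      simp only [RingHom.toMonoidHom_eq_coe, OneHom.toFun_eq_coe, MonoidHom.toOneHom_coe,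
        MonoidHom.coe_coe]
      rw [IsScalarTower.algebraMap_apply R S T, h₂, σ.commutes,
        ← IsScalarTower.algebraMap_apply] }
  have hG : G₁ = G₂ := by
    -- The two extensions agree modulo `m`, so unramifiedness makes them agree modulo every power of
    -- `m`. The intersection of these powers is zero by Krull, `B` being a Noetherian local domain.
    refine Algebra.FormallyUnramified.ext_of_iInf m
      (Ideal.iInf_pow_eq_bot_of_isDomain m (IsLocalRing.maximalIdeal.isMaximal B).ne_top) fun x => ?_
    have : (Ideal.Quotient.mk m).comp g₁ = (Ideal.Quotient.mk m).comp g₂ := by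
      refine IsLocalization.ringHom_ext (Submonoid.powers f) (RingHom.ext fun a => ?_)
      simp only [RingHom.comp_apply, h₁, h₂]
      rw [eq_comm, Ideal.Quotient.eq, ← map_sub]
      exact (IsLocalization.AtPrime.to_map_mem_maximal_iff B p _).mpr (hσ a)
    exact congr($this x)
  have h := congr($hG (algebraMap S T s))
  change g₁ _ = g₂ _ at h
  rw [h₁, h₂] at h
  exact (IsLocalization.injective B p.primeCompl_le_nonZeroDivisors h).symm

/-! ### Equivariant residue maps: surjectivity, uniqueness, primitivity -/

section Equivariant

variable {R S K L G : Type*} [CommRing R] [CommRing S] [Field K] [Field L] [Algebra K L]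
  [Algebra R S] [Group G] [MulSemiringAction G S] {ψ : R →+* K}
  {y : S →+* L} {τ : G ≃* Gal(L/K)}

/-- A faithful equivariant residue map is surjective. -/
theorem surjective_of_equivariant [IsGalois K L] (hψ : Function.Surjective ψ)
    (hy : ∀ r, y (algebraMap R S r) = algebraMap K L (ψ r))
    (hτ : ∀ (g : G) s, y (g • s) = τ g (y s))
    (hI : ∀ g : G, (∀ s, g • s - s ∈ RingHom.ker y) → g = 1) : Function.Surjective y := by
  -- The image of `y` contains `K` because `ψ` is surjective; it is a field because `L/K` is
  -- algebraic.
  let A : Subalgebra K L := { y.range with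
    algebraMap_mem' := fun k => by
      obtain ⟨r, rfl⟩ := hψ k
      exact ⟨_, hy r⟩ }
  let M : IntermediateField K L := subalgebraEquivIntermediateField A
  have hM : ∀ x, x ∈ M ↔ ∃ s, y s = x := fun x => mem_subalgebraEquivIntermediateField
  -- If `τ g` fixes the image of `y` pointwise, then `g` lies in the inertia group of `ker y`.
  have h1 : M.fixingSubgroup = ⊥ := by
    rw [eq_bot_iff]
    intro σ hσ
    obtain ⟨g, rfl⟩ := τ.surjective σ
    rw [IntermediateField.mem_fixingSubgroup_iff] at hσ
    rw [hI g fun s => ?_, map_one]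
    · exact Subgroup.one_mem _
    · rw [RingHom.mem_ker, map_sub, hτ, hσ _ ((hM _).mpr ⟨s, rfl⟩), sub_self]
  have h2 : M = ⊤ := by
    rw [← InfiniteGalois.fixedField_fixingSubgroup M, h1, IntermediateField.fixedField_bot]
  intro x
  exact (hM x).mp (h2 ▸ IntermediateField.mem_top)

theorem smul_mem_ker_of_equivariant (hτ : ∀ (g : G) s, y (g • s) = τ g (y s)) (g : G) {s : S}
    (hs : s ∈ RingHom.ker y) : g • s ∈ RingHom.ker y := by
  rw [RingHom.mem_ker] at hs ⊢
  rw [hτ, hs, map_zero]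

/-- The kernel of an equivariant residue map is the only prime above its restriction. -/
theorem eq_ker_of_equivariant [Finite G] [SMulCommClass G R S] [Algebra.IsInvariant R S G]
    (hy : ∀ r, y (algebraMap R S r) = algebraMap K L (ψ r))
    (hτ : ∀ (g : G) s, y (g • s) = τ g (y s))
    (q : Ideal S) [q.IsPrime] (hq : q.under R = RingHom.ker ψ) : q = RingHom.ker y := by
  have hker : (RingHom.ker y).under R = RingHom.ker ψ := by
    ext r
    rw [Ideal.under_def, Ideal.mem_comap, RingHom.mem_ker, RingHom.mem_ker, hy,
      map_eq_zero]
  have := RingHom.ker_isPrime y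
  obtain ⟨g, hg⟩ := Algebra.IsInvariant.exists_smul_of_under_eq R S G (RingHom.ker y) q
    (hker.trans hq.symm)
  rw [hg]
  ext s
  rw [Ideal.mem_pointwise_smul_iff_inv_smul_mem]
  refine ⟨fun h => ?_, smul_mem_ker_of_equivariant hτ _⟩
  simpa using smul_mem_ker_of_equivariant hτ g h

/-- A rational point of the quotient by `H` below a faithful equivariant point exists only for
`H = G`. -/
theorem eq_top_of_rational [CharZero K] [IsGalois K L] [Finite G] [SMulCommClass G R S]
    [Algebra.IsInvariant R S G] (hψ : Function.Surjective ψ)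
    (hy : ∀ r, y (algebraMap R S r) = algebraMap K L (ψ r))
    (hτ : ∀ (g : G) s, y (g • s) = τ g (y s))
    (hI : ∀ g : G, (∀ s, g • s - s ∈ RingHom.ker y) → g = 1)
    (H : Subgroup G) (A : Subring S) (hA : ∀ s, s ∈ A ↔ ∀ h ∈ H, h • s = s)
    (hRA : ∀ r, algebraMap R S r ∈ A)
    (z : A →+* K) (hz : ∀ r, z ⟨algebraMap R S r, hRA r⟩ = ψ r) : H = ⊤ := by
  have hsurj := surjective_of_equivariant hψ hy hτ hI
  have := Algebra.IsInvariant.isIntegral R S G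
  have : Algebra.IsIntegral A S := ⟨fun s => by
    obtain ⟨f, hf, hf'⟩ := Algebra.IsIntegral.isIntegral (R := R) s
    refine ⟨f.map ((algebraMap R S).codRestrict A hRA), hf.map _, ?_⟩
    rw [Polynomial.eval₂_map]
    exact hf'⟩
  have := RingHom.ker_isPrime z
  -- Lying over for the integral extension `A ⊆ S`. A prime above `ker z` lies above `ker ψ`, so it
  -- can only be `ker y`.
  obtain ⟨q, -, hq, hq'⟩ := Ideal.exists_ideal_over_prime_of_isIntegral (RingHom.ker z) (⊥ : Ideal S)
    (by
      rintro a (ha : (a : S) = 0)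
      rw [Subtype.ext (a2 := (0 : A)) ha]
      exact Ideal.zero_mem _)
  have hqA : ∀ a : A, (a : S) ∈ q ↔ z a = 0 := fun a => by
    rw [← RingHom.mem_ker, ← hq']
    rfl
  have hqy : q = RingHom.ker y := by
    refine eq_ker_of_equivariant hy hτ q ?_
    ext r
    rw [Ideal.under_def, Ideal.mem_comap, RingHom.mem_ker, ← hz]
    exact hqA ⟨_, hRA r⟩
  -- Modulo `ker z`, every element of `A` is congruent to one of `R`, and `ker z` lies below `ker
  -- y`. So `y` maps `A` into `K`.
  have hAK : ∀ a : A, y a = algebraMap K L (z a) := fun a => by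
    obtain ⟨r, hr⟩ := hψ (z a)
    have : (a : S) - algebraMap R S r ∈ RingHom.ker y := by
      rw [← hqy]
      refine (hqA (a - ⟨_, hRA r⟩)).mpr ?_
      rw [map_sub, hz, hr, sub_self]
    rw [RingHom.mem_ker, map_sub, sub_eq_zero] at this
    rw [this, hy, hr]
  have : Finite Gal(L/K) := .of_equiv _ τ.toEquiv
  have := IsGalois.finiteDimensional_of_finite K L
  -- Averaging: if `x = y s` is fixed by `H`, the sum of the `h • s` lies in `A` and is sent to `|H|
  -- x`, which is therefore in `K`.
  have key : IntermediateField.fixedField (H.map τ.toMonoidHom) = ⊥ := by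
    rw [eq_bot_iff]
    intro x hx
    obtain ⟨s, rfl⟩ := hsurj x
    have hx' : ∀ h ∈ H, y (h • s) = y s := fun h hh => by
      rw [hτ]
      exact (IntermediateField.mem_fixedField_iff _ _).mp hx _ ⟨h, hh, rfl⟩
    have := Fintype.ofFinite H
    have hs : ∑ h : H, (h : G) • s ∈ A := by
      rw [hA]
      intro h hh
      rw [Finset.smul_sum]
      refine Fintype.sum_equiv (Equiv.mulLeft (⟨h, hh⟩ : H)) _ _ fun i => ?_
      simp [mul_smul]
    have h1 := hAK ⟨_, hs⟩
    rw [map_sum, Finset.sum_congr rfl fun (h : H) _ => hx' h h.2, Finset.sum_const, nsmul_eq_mul] at h1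
    have hcard : ((Finset.univ : Finset H).card : K) ≠ 0 := by
      rw [Nat.cast_ne_zero]
      exact Finset.card_ne_zero.mpr ⟨1, Finset.mem_univ _⟩
    rw [IntermediateField.mem_bot]
    refine ⟨z ⟨_, hs⟩ / (Finset.univ : Finset H).card, ?_⟩
    rw [map_div₀, ← h1, map_natCast, mul_div_cancel_left₀]
    rw [← map_natCast (algebraMap K L)]
    exact (map_ne_zero _).mpr hcard
  have h2 : H.map τ.toMonoidHom = ⊤ := by
    rw [← IntermediateField.fixingSubgroup_fixedField (H.map τ.toMonoidHom), key,
      IntermediateField.fixingSubgroup_bot]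
  rw [eq_top_iff]
  intro g _
  have h3 : τ g ∈ H.map τ.toMonoidHom := h2 ▸ Subgroup.mem_top _
  obtain ⟨h, hh, hhg⟩ := h3
  exact τ.injective hhg ▸ hh

/-- Two faithful equivariant points above the same rational point are isomorphic. -/
theorem exists_algEquiv_of_equivariant [Finite G] [SMulCommClass G R S] [Algebra.IsInvariant R S G]
    {L' : Type*} [Field L'] [Algebra K L'] {y' : S →+* L'} {τ' : G ≃* Gal(L'/K)}
    (hψ : Function.Surjective ψ)
    (hy : ∀ r, y (algebraMap R S r) = algebraMap K L (ψ r))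
    (hτ : ∀ (g : G) s, y (g • s) = τ g (y s)) (hs : Function.Surjective y)
    (hy' : ∀ r, y' (algebraMap R S r) = algebraMap K L' (ψ r))
    (hτ' : ∀ (g : G) s, y' (g • s) = τ' g (y' s)) (hs' : Function.Surjective y') :
    ∃ e : L ≃ₐ[K] L', (∀ s, e (y s) = y' s) ∧ ∀ (g : G) a, e (τ g a) = τ' g (e a) := by
  have := RingHom.ker_isPrime y'
  have hker : RingHom.ker y' = RingHom.ker y := by
    refine eq_ker_of_equivariant hy hτ _ (Ideal.ext fun r => ?_)
    rw [Ideal.under_def, Ideal.mem_comap, RingHom.mem_ker, RingHom.mem_ker, hy', map_eq_zero]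
  let e₀ : L →+* L' := RingHom.liftOfSurjective y hs ⟨y', hker.ge⟩
  have he₀ : ∀ s, e₀ (y s) = y' s := fun s =>
    RingHom.liftOfRightInverse_comp_apply y _ _ ⟨y', hker.ge⟩ s
  let e₁ : L →ₐ[K] L' := { e₀ with
    commutes' := fun k => by
      obtain ⟨r, rfl⟩ := hψ k
      rw [← hy]
      exact (he₀ _).trans (hy' r) }
  have he₁ : ∀ s, e₁ (y s) = y' s := he₀
  have hbij : Function.Bijective e₁ := ⟨e₁.toRingHom.injective, fun b => by
    obtain ⟨s, rfl⟩ := hs' b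
    exact ⟨y s, he₁ s⟩⟩
  refine ⟨AlgEquiv.ofBijective e₁ hbij, he₁, fun g a => ?_⟩
  obtain ⟨s, rfl⟩ := hs a
  simp only [AlgEquiv.ofBijective_apply]
  rw [← hτ, he₁, he₁, hτ']

end Equivariant

/-! ### Construction of an equivariant point above a primitive point -/

section Existence

variable {R K G : Type*} {S : Type u} [CommRing R] [CommRing S] [Field K] [CharZero K]
  [Algebra R S] [Group G] [Finite G] [MulSemiringAction G S] [SMulCommClass G R S]
  [Algebra.IsInvariant R S G] {ψ : R →+* K}

/-- The residue field at a prime above a rational point is Galois, and its Galois group is a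
quotient of the decomposition group. -/
theorem exists_galois_residueField (hψ : Function.Surjective ψ) (p : Ideal S) [hp : p.IsPrime]
    (hpψ : p.under R = RingHom.ker ψ) :
    ∃ (L : Type u) (_ : Field L) (_ : Algebra K L) (_ : IsGalois K L) (y : S →+* L),
      Function.Surjective y ∧ RingHom.ker y = p ∧
      (∀ r, y (algebraMap R S r) = algebraMap K L (ψ r)) ∧
      (∀ σ : Gal(L/K), ∃ g ∈ MulAction.stabilizer G p, ∀ s, y (g • s) = σ (y s)) ∧
      ∀ g ∈ MulAction.stabilizer G p, ∃ σ : Gal(L/K), ∀ s, y (g • s) = σ (y s) := by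
  let P := p.under R
  have : P.IsMaximal := by
    rw [show P = RingHom.ker ψ from hpψ]
    exact RingHom.ker_isMaximal_of_surjective ψ hψ
  have := Algebra.IsInvariant.isIntegral R S G
  have : p.IsMaximal := Ideal.isMaximal_of_isIntegral_of_isMaximal_comap p ‹_›
  let L := S ⧸ p
  let y : S →+* L := Ideal.Quotient.mk p
  have hys : Function.Surjective y := Ideal.Quotient.mk_surjective
  let _ : Field L := Ideal.Quotient.field p
  let _ : Field (R ⧸ P) := Ideal.Quotient.field P
  have hle : RingHom.ker ψ ≤ RingHom.ker (y.comp (algebraMap R S)) := by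
    rw [← hpψ]
    intro r hr
    exact Ideal.Quotient.eq_zero_iff_mem.mpr hr
  let _ : Algebra K L :=
    (RingHom.liftOfSurjective ψ hψ ⟨y.comp (algebraMap R S), hle⟩).toAlgebra
  have hy : ∀ r, y (algebraMap R S r) = algebraMap K L (ψ r) := fun r =>
    (RingHom.liftOfRightInverse_comp_apply ψ _ _ ⟨y.comp (algebraMap R S), hle⟩ r).symm
  let _ : Algebra (R ⧸ P) K := (Ideal.Quotient.lift P ψ fun r hr => by
    rwa [← RingHom.mem_ker, ← hpψ]).toAlgebra
  have hRK : Function.Surjective (algebraMap (R ⧸ P) K) := fun k => by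
    obtain ⟨r, rfl⟩ := hψ k
    exact ⟨Ideal.Quotient.mk P r, rfl⟩
  have : IsScalarTower (R ⧸ P) K L := .of_algebraMap_eq fun r => by
    obtain ⟨r, rfl⟩ := Ideal.Quotient.mk_surjective r
    exact hy r
  -- In fact `R ⧸ P` is `K`; this form is what the theory of decomposition groups of residue fields
  -- takes as input.
  have : IsFractionRing (R ⧸ P) K := by
    have : FaithfulSMul (R ⧸ P) K :=
      (faithfulSMul_iff_algebraMap_injective _ _).mpr (algebraMap (R ⧸ P) K).injective
    refine IsFractionRing.of_field _ _ fun k => ?_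
    obtain ⟨r, rfl⟩ := hRK k
    exact ⟨r, 1, by rw [map_one, div_one]⟩
  have : Normal K L := Ideal.IsFractionRing.normal G P p K L
  -- Separability is automatic in characteristic zero, so normality suffices for `IsGalois`.
  refine ⟨L, inferInstance, inferInstance, { }, y, hys, Ideal.mk_ker, hy, fun σ => ?_,
    fun g hg => ?_⟩
  · obtain ⟨g, rfl⟩ := IsFractionRing.stabilizerHom_surjective G P p K L σ
    exact ⟨g, g.2, fun s => (IsFractionRing.stabilizerHom_apply_apply_mk G P p K L g s).symm⟩
  · exact ⟨IsFractionRing.stabilizerHom G P p K L ⟨g, hg⟩, fun s =>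
      (IsFractionRing.stabilizerHom_apply_apply_mk G P p K L ⟨g, hg⟩ s).symm⟩

/-- If no proper subgroup `H` admits a rational point on the spectrum of the `H`-invariants above
`ψ`, and the inertia group above `ψ` is trivial, then there is an equivariant point above `ψ`. -/
theorem exists_equivariant (hψ : Function.Surjective ψ)
    (hI : ∀ (p : Ideal S) [p.IsPrime], p.under R = RingHom.ker ψ →
      ∀ g : G, (∀ s, g • s - s ∈ p) → g = 1)
    (hH : ∀ (H : Subgroup G) (A : Subring S), (∀ s, s ∈ A ↔ ∀ h ∈ H, h • s = s) →
      ∀ (hRA : ∀ r, algebraMap R S r ∈ A) (z : A →+* K),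
      (∀ r, z ⟨algebraMap R S r, hRA r⟩ = ψ r) → H = ⊤)
    (hinj : Function.Injective (algebraMap R S)) :
    ∃ (L : Type u) (_ : Field L) (_ : Algebra K L) (_ : IsGalois K L) (y : S →+* L)
      (τ : G ≃* Gal(L/K)),
      (∀ r, y (algebraMap R S r) = algebraMap K L (ψ r)) ∧
      ∀ (g : G) s, y (g • s) = τ g (y s) := by
  have := Algebra.IsInvariant.isIntegral R S G
  have := RingHom.ker_isPrime ψ
  obtain ⟨p, -, hp, hpψ⟩ := Ideal.exists_ideal_over_prime_of_isIntegral (RingHom.ker ψ) (⊥ : Ideal S)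
    (by
      intro a ha
      rw [Ideal.mem_comap, Ideal.mem_bot, map_eq_zero_iff _ hinj] at ha
      rw [ha]
      exact Ideal.zero_mem _)
  obtain ⟨L, _, _, _, y, hys, hyp, hy, h1, h2⟩ := exists_galois_residueField (G := G) hψ p hpψ
  let D := MulAction.stabilizer G p
  let A : Subring S :=
    { carrier := {s | ∀ h ∈ D, h • s = s}
      mul_mem' := fun ha hb h hh => by rw [smul_mul', ha h hh, hb h hh]
      one_mem' := fun h _ => smul_one h
      add_mem' := fun ha hb h hh => by rw [smul_add, ha h hh, hb h hh]
      zero_mem' := fun h _ => smul_zero h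
      neg_mem' := fun ha h hh => by rw [smul_neg, ha h hh] }
  have hRA : ∀ r, algebraMap R S r ∈ A := fun r h _ => smul_algebraMap h r
  -- The decomposition group surjects onto `Gal(L/K)`, so residues of `D`-invariants are
  -- Galois-invariant.
  have hAK : ∀ a : A, y a ∈ (algebraMap K L).range := fun a => by
    refine (InfiniteGalois.mem_range_algebraMap_iff_fixed _).mpr fun σ => ?_
    obtain ⟨g, hg, hgσ⟩ := h1 σ
    rw [← hgσ, a.2 g hg]
  let e : K ≃+* (algebraMap K L).range :=
    RingEquiv.ofBijective (algebraMap K L).rangeRestrict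
      ⟨fun _ _ h => (algebraMap K L).injective congr(Subtype.val $h),
        (algebraMap K L).rangeRestrict_surjective⟩
  -- The restriction of `y` to `A` is a rational point of `Spec A` above `ψ`, which `hH` allows only
  -- for the full group.
  have hD : D = ⊤ := by
    refine hH D A (fun s => Iff.rfl) hRA
      (e.symm.toRingHom.comp ((y.comp A.subtype).codRestrict _ hAK)) fun r => ?_
    exact e.symm_apply_eq.mpr (Subtype.ext (hy r))
  choose σ hσ using fun g : G => h2 g (hD ▸ Subgroup.mem_top g : g ∈ D)
  let τ : G →* Gal(L/K) := MonoidHom.mk' σ fun g h => by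
    ext a
    obtain ⟨s, rfl⟩ := hys a
    rw [AlgEquiv.mul_apply, ← hσ, ← hσ, ← hσ, mul_smul]
  have hτ : Function.Bijective τ := by
    refine ⟨(injective_iff_map_eq_one τ).mpr fun g hg => hI p hpψ g fun s => ?_, fun f => ?_⟩
    · have : y (g • s) = y s := by
        rw [hσ]
        exact congr($hg (y s))
      rw [← hyp, RingHom.mem_ker, map_sub, this, sub_self]
    · obtain ⟨g, -, hg⟩ := h1 f
      refine ⟨g, AlgEquiv.ext fun a => ?_⟩
      obtain ⟨s, rfl⟩ := hys a
      rw [← hg]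
      exact (hσ g s).symm
  exact ⟨L, _, _, ‹_›, y, MulEquiv.ofBijective τ hτ, hy, fun g s => hσ g s⟩

end Existence

end Algebra

/-! ### Translation between schemes and rings: affine charts and the unramified loci -/

section Charts

variable {K : Type u} [Field K] {G : Type v} [Group G] {Y X : Over (base K)}
  {ρ : G →* Aut Y} {π : Y ⟶ X}

/-- The left action of `G` on the functions on `π⁻¹ U`: `g` acts as the pull-back along `g⁻¹`. -/
abbrev sectionsAction (hinv : ∀ g : G, (ρ g).hom ≫ π = π) (U : X.left.Opens) :
    MulSemiringAction G Γ(Y.left, π.left ⁻¹ᵁ U) where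
  smul g s := (ρ g⁻¹).hom.left.appLE _ _ (preimage_eq hinv g⁻¹ U).ge s
  one_smul s := by
    change (ρ 1⁻¹).hom.left.appLE _ _ _ s = s
    have key : ∀ (f : Y.left ⟶ Y.left) (e), f = 𝟙 _ →
        f.appLE (π.left ⁻¹ᵁ U) (π.left ⁻¹ᵁ U) e s = s := by
      rintro _ e rfl
      exact congr($(Y.left.presheaf.map_id _) s)
    exact key _ _ (by rw [inv_one, map_one]; rfl)
  mul_smul g h s := by
    change (ρ (g * h)⁻¹).hom.left.appLE _ _ _ s =
      (ρ g⁻¹).hom.left.appLE _ _ _ ((ρ h⁻¹).hom.left.appLE _ _ _ s)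
    rw [← CommRingCat.comp_apply, Scheme.Hom.appLE_comp_appLE]
    have h : (ρ (g * h)⁻¹).hom.left = (ρ g⁻¹).hom.left ≫ (ρ h⁻¹).hom.left := by
      rw [mul_inv_rev, map_mul, Aut.Aut_mul_def]; rfl
    simp only [h]
  smul_zero g := map_zero ((ρ g⁻¹).hom.left.appLE _ _ (preimage_eq hinv g⁻¹ U).ge).hom
  smul_one g := map_one ((ρ g⁻¹).hom.left.appLE _ _ (preimage_eq hinv g⁻¹ U).ge).hom
  smul_add g := map_add ((ρ g⁻¹).hom.left.appLE _ _ (preimage_eq hinv g⁻¹ U).ge).hom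
  smul_mul g := map_mul ((ρ g⁻¹).hom.left.appLE _ _ (preimage_eq hinv g⁻¹ U).ge).hom

/-- The action is by pull-back along `g⁻¹`, whereas `invariantSections` pulls back along `h`; a
subgroup is closed under inverses, so the invariants agree. -/
lemma mem_invariantSections_iff (hinv : ∀ g : G, (ρ g).hom ≫ π = π) (H : Subgroup G)
    (U : X.left.Opens) (s : Γ(Y.left, π.left ⁻¹ᵁ U)) :
    letI := sectionsAction hinv U
    s ∈ invariantSections ρ π H U ↔ ∀ h ∈ H, h • s = s := by
  refine ⟨fun hs h hh => hs h⁻¹ (H.inv_mem hh) _, fun hs h hh e => ?_⟩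
  conv_rhs => rw [← hs h⁻¹ (H.inv_mem hh)]
  change _ = (ρ h⁻¹⁻¹).hom.left.appLE _ _ _ s
  congr 2
  simp only [inv_inv]

/-- The `Γ(X, U)`-algebra `Γ(Y, π⁻¹ U)`. -/
abbrev sectionsAlgebra (π : Y ⟶ X) (U : X.left.Opens) :
    Algebra Γ(X.left, U) Γ(Y.left, π.left ⁻¹ᵁ U) :=
  (π.left.app U).hom.toAlgebra

lemma smulCommClass_sections (hinv : ∀ g : G, (ρ g).hom ≫ π = π) (U : X.left.Opens) :
    letI := sectionsAction hinv U
    letI := sectionsAlgebra π U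
    SMulCommClass G Γ(X.left, U) Γ(Y.left, π.left ⁻¹ᵁ U) := by
  let := sectionsAction hinv U
  let := sectionsAlgebra π U
  refine ⟨fun g r s => ?_⟩
  have h : g • algebraMap Γ(X.left, U) Γ(Y.left, π.left ⁻¹ᵁ U) r = algebraMap _ _ r :=
    (mem_invariantSections_iff hinv ⊤ U _).mp (app_mem hinv ⊤ U r) g (Subgroup.mem_top g)
  rw [Algebra.smul_def, Algebra.smul_def, smul_mul', h]

lemma IsQuotient.isInvariant_sections (hπ : IsQuotient ρ π) (U : X.left.Opens) :
    letI := sectionsAction hπ.invariant U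
    letI := sectionsAlgebra π U
    Algebra.IsInvariant Γ(X.left, U) Γ(Y.left, π.left ⁻¹ᵁ U) G := by
  let := sectionsAction hπ.invariant U
  let := sectionsAlgebra π U
  refine ⟨fun s hs => ?_⟩
  have : s ∈ (π.left.app U).hom.range := by
    rw [hπ.range_eq, mem_invariantSections_iff hπ.invariant]
    exact fun h _ => hs h
  exact this

lemma IsQuotient.isAffineOpen_preimage (hπ : IsQuotient ρ π) {U : X.left.Opens}
    (hU : IsAffineOpen U) : IsAffineOpen (π.left ⁻¹ᵁ U) :=
  have := hπ.isAffineHom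
  hU.preimage π.left

/-- Each section is a root of the product of the `T - g • s` over `g ∈ G`, whose coefficients are
invariant. The consequence needed later is that `π` is closed. -/
lemma IsQuotient.isIntegralHom [Finite G] (hπ : IsQuotient ρ π) : IsIntegralHom π.left := by
  have := hπ.isAffineHom
  refine ⟨fun U hU => ?_⟩
  let := sectionsAction hπ.invariant U
  let := sectionsAlgebra π U
  have := smulCommClass_sections hπ.invariant U
  have := hπ.isInvariant_sections U
  exact (Algebra.IsInvariant.isIntegral Γ(X.left, U) Γ(Y.left, π.left ⁻¹ᵁ U) G).isIntegral

/-- A morphism from an affine scheme into an affine open is given by a ring homomorphism. -/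
lemma exists_SpecMap_fromSpec {Z : Scheme.{u}} {U : Z.Opens} (hU : IsAffineOpen U)
    {A : CommRingCat.{u}} (f : Spec A ⟶ Z) (hf : ∀ a, f a ∈ U) :
    ∃ φ : Γ(Z, U) ⟶ A, Spec.map φ ≫ hU.fromSpec = f := by
  have h : Set.range f ⊆ Set.range hU.fromSpec := by
    rw [hU.range_fromSpec]
    rintro _ ⟨a, rfl⟩
    exact hf a
  obtain ⟨φ, hφ⟩ := Spec.map_surjective (IsOpenImmersion.lift hU.fromSpec f h)
  exact ⟨φ, by rw [hφ, IsOpenImmersion.lift_fac]⟩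

lemma SpecMap_fromSpec_injective {Z : Scheme.{u}} {U : Z.Opens} (hU : IsAffineOpen U)
    {A : CommRingCat.{u}} {φ φ' : Γ(Z, U) ⟶ A}
    (h : Spec.map φ ≫ hU.fromSpec = Spec.map φ' ≫ hU.fromSpec) : φ = φ' :=
  Spec.map_injective ((cancel_mono hU.fromSpec).mp h)

/-- A rational point of `X` in an affine chart. -/
lemma exists_chart (x : pt K ⟶ X) :
    ∃ (U : X.left.Opens) (hU : IsAffineOpen U) (ψ : Γ(X.left, U) ⟶ CommRingCat.of K),
      Spec.map ψ ≫ hU.fromSpec = x.left ∧ Function.Surjective ψ := by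
  obtain ⟨U, hU, hxU⟩ : ∃ U : X.left.Opens, IsAffineOpen U ∧
      x.left (IsLocalRing.closedPoint K) ∈ U := by
    obtain ⟨U, hU, hx, -⟩ := exists_isAffineOpen_mem_and_subset (X := X.left)
      (U := ⊤) (x := x.left (IsLocalRing.closedPoint K)) trivial
    exact ⟨U, hU, hx⟩
  obtain ⟨ψ, hψ⟩ := exists_SpecMap_fromSpec hU x.left fun a => by
    rwa [Subsingleton.elim (α := PrimeSpectrum K) a (IsLocalRing.closedPoint K)]
  -- The structure map `K → Γ(X, U)` is a section of `ψ`, whence surjectivity.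
  obtain ⟨κ, hκ⟩ := Spec.map_surjective (hU.fromSpec ≫ X.hom)
  have h : κ ≫ ψ = 𝟙 (CommRingCat.of K) := by
    apply Spec.map_injective
    rw [Spec.map_comp, hκ, reassoc_of% hψ, Spec.map_id]
    exact Over.w x
  exact ⟨U, hU, ψ, hψ, fun a => ⟨κ a, congr($h a)⟩⟩

lemma SpecMap_closedPoint_asIdeal {A : CommRingCat.{u}} {L : Type u} [Field L]
    (φ : A ⟶ CommRingCat.of L) (a : Spec (CommRingCat.of L)) :
    (Spec.map φ a).asIdeal = RingHom.ker φ.hom := by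
  have h : a = (⟨⊥, Ideal.isPrime_bot⟩ : PrimeSpectrum L) :=
    Subsingleton.elim (α := PrimeSpectrum L) _ _
  rw [h]
  rfl

/-- An inertia group at a point of `Y°` is trivial. -/
theorem IsQuotient.eq_one_of_inertia [Finite G] (hπ : IsQuotient ρ π) (hY : IsVariety Y)
    (hρ : Function.Injective ρ) {U : X.left.Opens} (hU : IsAffineOpen U)
    (p : Spec Γ(Y.left, π.left ⁻¹ᵁ U))
    (hp : (hπ.isAffineOpen_preimage hU).fromSpec p ∈ unramY π) (g : G)
    (hg : letI := sectionsAction hπ.invariant U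
      ∀ s : Γ(Y.left, π.left ⁻¹ᵁ U), g • s - s ∈ p.asIdeal) : g = 1 := by
  let := sectionsAction hπ.invariant U
  let := sectionsAlgebra π U
  have := smulCommClass_sections hπ.invariant U
  have hV := hπ.isAffineOpen_preimage hU
  have := hY.isIntegral
  have := hY.isSeparated
  have := hY.locallyOfFiniteType
  obtain ⟨(W : Y.left.Opens), hW, hpW⟩ := TopologicalSpace.Opens.mem_sSup.mp hp
  have hW : FormallyUnramified (W.ι ≫ π.left) := hW
  -- Shrink to a basic open of the chart that contains `p` and lies in an open on which `π` is
  -- unramified.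
  obtain ⟨_, ⟨f, rfl⟩, hpf, hfW⟩ :=
    PrimeSpectrum.isTopologicalBasis_basic_opens.exists_subset_of_mem_open
      (show p ∈ (hV.fromSpec ⁻¹ᵁ W : Set _) from hpW) (hV.fromSpec ⁻¹ᵁ W).isOpen
  let B := Y.left.basicOpen f
  have hB : IsAffineOpen B := hV.basicOpen f
  have hBW : B ≤ W := by
    change Y.left.basicOpen f ≤ W
    rw [← hV.fromSpec_image_basicOpen f]
    rintro _ ⟨a, ha, rfl⟩
    exact hfW ha
  have hBV : B ≤ π.left ⁻¹ᵁ U := Y.left.basicOpen_le f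
  have hunr : FormallyUnramified (Spec.map (π.left.appLE U B hBV)) := by
    have : FormallyUnramified (Spec.map (π.left.appLE U B hBV) ≫ hU.fromSpec) := by
      rw [hU.SpecMap_appLE_fromSpec _ hB, ← hB.isoSpec_inv_ι, ← Y.left.homOfLE_ι hBW]
      simp only [Category.assoc]
      exact MorphismProperty.comp_mem _ _ _ inferInstance
        (MorphismProperty.comp_mem _ _ _ inferInstance hW)
    exact FormallyUnramified.of_comp _ hU.fromSpec
  rw [HasRingHomProperty.Spec_iff (P := @FormallyUnramified)] at hunr
  let : Algebra Γ(X.left, U) Γ(Y.left, B) := (π.left.appLE U B hBV).hom.toAlgebra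
  let : Algebra Γ(Y.left, π.left ⁻¹ᵁ U) Γ(Y.left, B) :=
    (Y.left.presheaf.map (homOfLE hBV).op).hom.toAlgebra
  have : Algebra.FormallyUnramified Γ(X.left, U) Γ(Y.left, B) := hunr
  have : IsLocalization.Away f Γ(Y.left, B) := hV.isLocalization_basicOpen f
  have : IsScalarTower Γ(X.left, U) Γ(Y.left, π.left ⁻¹ᵁ U) Γ(Y.left, B) :=
    .of_algebraMap_eq' rfl
  have : Nonempty (π.left ⁻¹ᵁ U : Y.left.Opens) := ⟨⟨hV.fromSpec p, by
    have : hV.fromSpec p ∈ Set.range hV.fromSpec := ⟨p, rfl⟩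
    rwa [hV.range_fromSpec] at this⟩⟩
  have : IsLocallyNoetherian Y.left := LocallyOfFiniteType.isLocallyNoetherian Y.hom
  have : IsNoetherianRing Γ(Y.left, π.left ⁻¹ᵁ U) :=
    IsLocallyNoetherian.component_noetherian ⟨_, hV⟩
  have : p.asIdeal.IsPrime := p.2
  have key : ∀ s : Γ(Y.left, π.left ⁻¹ᵁ U), g • s = s :=
    algHom_apply_eq_of_sub_mem (T := Γ(Y.left, B)) p.asIdeal (f := f) hpf
      (MulSemiringAction.toAlgHom Γ(X.left, U) Γ(Y.left, π.left ⁻¹ᵁ U) g) hg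
  have h1 : hV.fromSpec ≫ (ρ g⁻¹).hom.left = hV.fromSpec ≫ 𝟙 Y.left := by
    rw [← hV.SpecMap_appLE_fromSpec _ hV (preimage_eq hπ.invariant g⁻¹ U).ge,
      show (ρ g⁻¹).hom.left.appLE _ _ (preimage_eq hπ.invariant g⁻¹ U).ge = 𝟙 _ from
        CommRingCat.hom_ext (RingHom.ext key), Spec.map_id, Category.id_comp, Category.comp_id]
  have : IsDominant hV.fromSpec := by
    refine ⟨hV.fromSpec.isOpenEmbedding.isOpen_range.dense ⟨_, ⟨p, rfl⟩⟩⟩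
  -- The automorphism is the identity on a nonempty open of an integral scheme, which is dense, and
  -- `Y` is reduced and separated over `K`.
  have h2 : (ρ g⁻¹).hom.left = 𝟙 Y.left :=
    ext_of_isDominant_of_isSeparated Y.hom
      ((Over.w (ρ g⁻¹).hom).trans (Category.id_comp _).symm) hV.fromSpec h1
  have h3 : ρ g⁻¹ = ρ 1 := by
    rw [map_one]
    exact Iso.ext (Over.OverMorphism.ext h2)
  rw [← inv_eq_one]
  exact hρ h3

lemma mem_unramY_of_mem_unramX {y : Y.left} (h : π.left y ∈ unramX π) : y ∈ unramY π := by
  obtain ⟨(U : X.left.Opens), hU, hyU⟩ := TopologicalSpace.Opens.mem_sSup.mp h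
  have hU : FormallyUnramified (π.left ∣_ U) := hU
  refine TopologicalSpace.Opens.mem_sSup.mpr ⟨π.left ⁻¹ᵁ U, ?_, hyU⟩
  change FormallyUnramified ((π.left ⁻¹ᵁ U).ι ≫ π.left)
  rw [← morphismRestrict_ι]
  exact MorphismProperty.comp_mem _ _ _ hU inferInstance

/-- As `π` is closed, the complement of the image of `Wᶜ` is an open `U` whose preimage lies in `W`.
It contains `π y` because the fibre of `y` is reduced to `y`, which lies in `W`. -/
lemma IsQuotient.mem_unramX_of_mem_unramY [Finite G] (hπ : IsQuotient ρ π) {y : Y.left}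
    (h : y ∈ unramY π) (huniq : ∀ y' : Y.left, π.left y' = π.left y → y' = y) :
    π.left y ∈ unramX π := by
  obtain ⟨(W : Y.left.Opens), hW, hyW⟩ := TopologicalSpace.Opens.mem_sSup.mp h
  have hW : FormallyUnramified (W.ι ≫ π.left) := hW
  have := hπ.isIntegralHom
  have hcl : IsClosed (π.left '' (W : Set Y.left)ᶜ) :=
    π.left.isClosedMap _ W.isOpen.isClosed_compl
  let U : X.left.Opens := ⟨_, hcl.isOpen_compl⟩
  have hUW : π.left ⁻¹ᵁ U ≤ W := fun a ha => by
    by_contra h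
    exact ha ⟨a, h, rfl⟩
  refine TopologicalSpace.Opens.mem_sSup.mpr ⟨U, ?_, ?_⟩
  · change FormallyUnramified (π.left ∣_ U)
    have : FormallyUnramified (π.left ∣_ U ≫ U.ι) := by
      rw [morphismRestrict_ι, ← Y.left.homOfLE_ι hUW]
      simp only [Category.assoc]
      exact MorphismProperty.comp_mem _ _ _ inferInstance hW
    exact FormallyUnramified.of_comp _ U.ι
  · rintro ⟨a, ha, hay⟩
    exact ha (huniq a hay ▸ hyW)

/-- The affine chart `Spec (Γ(π⁻¹ U, 𝒪_Y)ᴴ)` of `Y/H` over the affine open `U ⊆ X`. -/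
lemma exists_interQuotient_chart [Finite G] (hπ : IsQuotient ρ π) (H : Subgroup G)
    {U : X.left.Opens} (hU : IsAffineOpen U) :
    ∃ j : Spec (.of (invariantSections ρ π H U)) ⟶ (interQuotient hπ H).left,
      IsOpenImmersion j ∧
      j ≫ (interQuotientMap hπ H).left =
        Spec.map (CommRingCat.ofHom
          ((π.left.app U).hom.codRestrict _ (app_mem hπ.invariant H U))) ≫ hU.fromSpec ∧
      Set.range j = (interQuotientMap hπ H).left ⁻¹' U := by
  have := hπ.isAffineHom
  let d := interData hπ.invariant H
  have : (d.functor ⋙ Scheme.forget).IsLocallyDirected :=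
    Scheme.Cover.RelativeGluingData.instIsLocallyDirectedI₀CompFunctorForgetOfIsThin ..
  refine ⟨d.cover.f ⟨U, hU⟩, ?_, ?_, ?_⟩
  · exact d.cover.map_prop _
  · exact colimit.ι_desc _ _
  · refine (d.preimage_toBase_eq_range_ι ⟨U, hU⟩).symm.trans ?_
    change d.toBase ⁻¹' Set.range U.ι = d.toBase ⁻¹' U
    rw [Scheme.Opens.range_ι]

end Charts

/-! ### Equivariant points and points of `Y°/H` as ring homomorphisms -/

section PointsInCharts

variable {K : Type u} [Field K] {G : Type v} [Group G] {Y X : Over (base K)}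
  {ρ : G →* Aut Y} {π : Y ⟶ X}

/-- Factoring through an open subscheme is a condition on the underlying points, so membership in
`X°(K)` and in `Y°{K}` can be checked pointwise. -/
lemma exists_comp_openIncl_iff {T X : Over (base K)} (W : X.left.Opens) (f : T ⟶ X) :
    (∃ f' : T ⟶ openSub X W, f' ≫ openIncl X W = f) ↔ ∀ a, f.left a ∈ W := by
  constructor
  · rintro ⟨f', rfl⟩ a
    exact (f'.left a).2
  · intro h
    have hr : Set.range f.left ⊆ Set.range W.ι := by
      rw [Scheme.Opens.range_ι]
      rintro _ ⟨a, rfl⟩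
      exact h a
    refine ⟨Over.homMk (IsOpenImmersion.lift W.ι f.left hr) ?_, Over.OverMorphism.ext ?_⟩
    · change IsOpenImmersion.lift W.ι f.left hr ≫ W.ι ≫ X.hom = T.hom
      rw [IsOpenImmersion.lift_fac_assoc, Over.w]
    · exact IsOpenImmersion.lift_fac W.ι f.left hr

lemma left_apply_eq_of_comp_eq {L : LargeField.{u, v} G K} {y : specOver K L.carrier ⟶ Y}
    {x : pt K ⟶ X} (h : y ≫ π = toPt K L.carrier ≫ x) (a : Spec (.of L.carrier)) (b : base K) :
    π.left (y.left a) = x.left b := by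
  have h1 : y.left ≫ π.left = (toPt K L.carrier).left ≫ x.left := congr($(h).left)
  rw [← Scheme.Hom.comp_apply, h1, Scheme.Hom.comp_apply]
  congr 1
  exact Subsingleton.elim (α := PrimeSpectrum K) _ _

variable {U : X.left.Opens} {x : pt K ⟶ X} {ψ : Γ(X.left, U) ⟶ CommRingCat.of K}

lemma left_apply_mem (hU : IsAffineOpen U) (hψ : Spec.map ψ ≫ hU.fromSpec = x.left) (b : base K) :
    x.left b ∈ U := by
  rw [← hψ, Scheme.Hom.comp_apply]
  have : hU.fromSpec (Spec.map ψ b) ∈ Set.range hU.fromSpec := ⟨_, rfl⟩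
  rwa [hU.range_fromSpec] at this

/-- The primes above a rational point are the points of the fibre. -/
lemma IsQuotient.left_fromSpec_eq_iff (hπ : IsQuotient ρ π) (hU : IsAffineOpen U)
    (hψ : Spec.map ψ ≫ hU.fromSpec = x.left) (q : Spec Γ(Y.left, π.left ⁻¹ᵁ U)) (b : base K) :
    π.left ((hπ.isAffineOpen_preimage hU).fromSpec q) = x.left b ↔
      letI := sectionsAlgebra π U
      q.asIdeal.under Γ(X.left, U) = RingHom.ker ψ.hom := by
  have hV := hπ.isAffineOpen_preimage hU
  rw [← hψ, ← Scheme.Hom.comp_apply, ← hU.SpecMap_appLE_fromSpec π.left hV le_rfl,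
    Scheme.Hom.comp_apply, Scheme.Hom.comp_apply, hU.fromSpec.injective.eq_iff,
    ← Scheme.Hom.app_eq_appLE]
  exact PrimeSpectrum.ext_iff.trans (Eq.congr_right (SpecMap_closedPoint_asIdeal ψ b))

/-- An equivariant point in an affine chart. -/
lemma IsQuotient.exists_ringHom (hπ : IsQuotient ρ π) (hU : IsAffineOpen U)
    (hψ : Spec.map ψ ≫ hU.fromSpec = x.left) {L : LargeField.{u, v} G K}
    (y : EquivariantPoint ρ L) (hy : y.1 ≫ π = toPt K L.carrier ≫ x) :
    ∃ φ : Γ(Y.left, π.left ⁻¹ᵁ U) ⟶ CommRingCat.of L.carrier,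
      Spec.map φ ≫ (hπ.isAffineOpen_preimage hU).fromSpec = y.1.left ∧
      (letI := sectionsAlgebra π U
        ∀ r, φ.hom (algebraMap Γ(X.left, U) _ r) = algebraMap K L.carrier (ψ.hom r)) ∧
      (letI := sectionsAction hπ.invariant U
        ∀ (g : G) s, φ.hom (g • s) = L.iso.symm g (φ.hom s)) := by
  have hV := hπ.isAffineOpen_preimage hU
  have hyl : y.1.left ≫ π.left =
      Spec.map (CommRingCat.ofHom (algebraMap K L.carrier)) ≫ x.left := congr($(hy).left)
  obtain ⟨φ, hφ⟩ := exists_SpecMap_fromSpec hV y.1.left fun a => by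
    change π.left (y.1.left a) ∈ U
    rw [left_apply_eq_of_comp_eq hy a (IsLocalRing.closedPoint K)]
    exact left_apply_mem hU hψ _
  refine ⟨φ, hφ, fun r => ?_, fun g s => ?_⟩
  · have h : π.left.app U ≫ φ = ψ ≫ CommRingCat.ofHom (algebraMap K L.carrier) := by
      apply SpecMap_fromSpec_injective hU
      rw [Spec.map_comp, Category.assoc, Scheme.Hom.app_eq_appLE,
        hU.SpecMap_appLE_fromSpec π.left hV le_rfl, reassoc_of% hφ, hyl, Spec.map_comp,
        Category.assoc, hψ]
    exact congr($h r)
  -- Both `Spec L` and the sections carry actions through inverses, so equivariance of `y` at `g⁻¹`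
  -- is equivariance of `φ` at `g`.
  · have h : (ρ g⁻¹).hom.left.appLE _ _ (preimage_eq hπ.invariant g⁻¹ U).ge ≫ φ =
        φ ≫ CommRingCat.ofHom (L.iso.symm g⁻¹⁻¹ : L.carrier →+* L.carrier) := by
      apply SpecMap_fromSpec_injective hV
      rw [Spec.map_comp, Category.assoc, hV.SpecMap_appLE_fromSpec _ hV, reassoc_of% hφ,
        Spec.map_comp, Category.assoc, hφ]
      exact congr($(y.2 g⁻¹).left).symm
    rw [inv_inv] at h
    exact congr($h s)

/-- An equivariant point given by a ring homomorphism on an affine chart. -/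
lemma IsQuotient.exists_equivariantPoint (hπ : IsQuotient ρ π) (hU : IsAffineOpen U)
    (hψ : Spec.map ψ ≫ hU.fromSpec = x.left) {L : LargeField.{u, v} G K}
    (φ : Γ(Y.left, π.left ⁻¹ᵁ U) ⟶ CommRingCat.of L.carrier)
    (h1 : letI := sectionsAlgebra π U
      ∀ r, φ.hom (algebraMap Γ(X.left, U) _ r) = algebraMap K L.carrier (ψ.hom r))
    (h2 : letI := sectionsAction hπ.invariant U
      ∀ (g : G) s, φ.hom (g • s) = L.iso.symm g (φ.hom s)) :
    ∃ y : EquivariantPoint ρ L, y.1 ≫ π = toPt K L.carrier ≫ x := by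
  have hV := hπ.isAffineOpen_preimage hU
  have h3 : (Spec.map φ ≫ hV.fromSpec) ≫ π.left =
      Spec.map (CommRingCat.ofHom (algebraMap K L.carrier)) ≫ x.left := by
    rw [Category.assoc, ← hU.SpecMap_appLE_fromSpec π.left hV le_rfl, ← hψ, ← Spec.map_comp_assoc,
      ← Spec.map_comp_assoc, ← Scheme.Hom.app_eq_appLE]
    congr 2
    exact CommRingCat.hom_ext (RingHom.ext h1)
  let y : specOver K L.carrier ⟶ Y := Over.homMk (Spec.map φ ≫ hV.fromSpec) (by
    rw [← Over.w π, ← Category.assoc, h3, Category.assoc, Over.w x]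
    exact Category.comp_id _)
  refine ⟨⟨y, fun g => Over.OverMorphism.ext ?_⟩, Over.OverMorphism.ext h3⟩
  change Spec.map (CommRingCat.ofHom (L.iso.symm g⁻¹ : L.carrier →+* L.carrier)) ≫
    Spec.map φ ≫ hV.fromSpec = (Spec.map φ ≫ hV.fromSpec) ≫ (ρ g).hom.left
  rw [Category.assoc, ← hV.SpecMap_appLE_fromSpec _ hV (preimage_eq hπ.invariant g U).ge,
    ← Spec.map_comp_assoc, ← Spec.map_comp_assoc]
  congr 2
  ext s
  refine (h2 g⁻¹ s).symm.trans ?_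
  change φ ((ρ g⁻¹⁻¹).hom.left.appLE _ _ _ s) = φ ((ρ g).hom.left.appLE _ _ _ s)
  simp only [inv_inv]

/-- The fibre of an equivariant point is a single point. -/
lemma IsQuotient.eq_of_left_apply_eq [Finite G] (hπ : IsQuotient ρ π) {L : LargeField.{u, v} G K}
    (y : EquivariantPoint ρ L) (hy : y.1 ≫ π = toPt K L.carrier ≫ x) (a : Spec (.of L.carrier))
    (q : Y.left) (hq : π.left q = π.left (y.1.left a)) : q = y.1.left a := by
  obtain ⟨U, hU, ψ, hψ, -⟩ := exists_chart x
  let := sectionsAction hπ.invariant U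
  let := sectionsAlgebra π U
  have := smulCommClass_sections hπ.invariant U
  have := hπ.isInvariant_sections U
  have hV := hπ.isAffineOpen_preimage hU
  obtain ⟨φ, hφ, h1, h2⟩ := hπ.exists_ringHom hU hψ y hy
  rw [left_apply_eq_of_comp_eq hy a (IsLocalRing.closedPoint K)] at hq
  have hqV : q ∈ Set.range hV.fromSpec := by
    rw [hV.range_fromSpec]
    change π.left q ∈ U
    rw [hq]
    exact left_apply_mem hU hψ _
  obtain ⟨q, rfl⟩ := hqV
  replace hq := (hπ.left_fromSpec_eq_iff hU hψ q (IsLocalRing.closedPoint K)).mp hq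
  have := q.2
  have h3 := eq_ker_of_equivariant h1 h2 q.asIdeal hq
  rw [← hφ, Scheme.Hom.comp_apply]
  congr 1
  exact PrimeSpectrum.ext (h3.trans (SpecMap_closedPoint_asIdeal φ a).symm)

/-- A rational point of `Y°/H` in an affine chart. -/
lemma IsQuotient.exists_ringHom_invariantSections [Finite G] (hπ : IsQuotient ρ π)
    (hU : IsAffineOpen U) (hψ : Spec.map ψ ≫ hU.fromSpec = x.left) (H : Subgroup G)
    (z : pt K ⟶ unramInterQuotient hπ H) (hz : z ≫ unramInterQuotientMap hπ H = x) :
    ∃ ζ : invariantSections ρ π H U →+* K,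
      ∀ r, ζ ⟨π.left.app U r, app_mem hπ.invariant H U r⟩ = ψ.hom r := by
  obtain ⟨j, hj, hjX, hjr⟩ := exists_interQuotient_chart hπ H hU
  let w : pt K ⟶ interQuotient hπ H := z ≫ openIncl _ _
  have hw : w.left ≫ (interQuotientMap hπ H).left = x.left := congr($(hz).left)
  have hwr : Set.range w.left ⊆ Set.range j := by
    rw [hjr]
    rintro _ ⟨b, rfl⟩
    change (interQuotientMap hπ H).left (w.left b) ∈ U
    rw [← Scheme.Hom.comp_apply, hw]
    exact left_apply_mem hU hψ b
  obtain ⟨ζ, hζ⟩ := Spec.map_surjective (IsOpenImmersion.lift j w.left hwr)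
  have h : CommRingCat.ofHom ((π.left.app U).hom.codRestrict _ (app_mem hπ.invariant H U)) ≫ ζ = ψ := by
    apply SpecMap_fromSpec_injective hU
    rw [Spec.map_comp, Category.assoc, ← hjX, hζ, IsOpenImmersion.lift_fac_assoc, hw, hψ]
  exact ⟨ζ.hom, fun r => congr($h r)⟩

/-- A rational point of `Y°/H` given by a ring homomorphism on an affine chart. -/
lemma IsQuotient.exists_comp_unramInterQuotientMap [Finite G] (hπ : IsQuotient ρ π)
    (hU : IsAffineOpen U) (hψ : Spec.map ψ ≫ hU.fromSpec = x.left) (H : Subgroup G)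
    (hx : ∀ b, x.left b ∈ unramX π) (ζ : invariantSections ρ π H U →+* K)
    (hζ : ∀ r, ζ ⟨π.left.app U r, app_mem hπ.invariant H U r⟩ = ψ.hom r) :
    ∃ z : pt K ⟶ unramInterQuotient hπ H, z ≫ unramInterQuotientMap hπ H = x := by
  obtain ⟨j, -, hjX, -⟩ := exists_interQuotient_chart hπ H hU
  have hw : (Spec.map (CommRingCat.ofHom ζ) ≫ j) ≫ (interQuotientMap hπ H).left = x.left := by
    rw [Category.assoc, hjX, ← Spec.map_comp_assoc, ← hψ]
    congr 2
    exact CommRingCat.hom_ext (RingHom.ext hζ)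
  let w : pt K ⟶ interQuotient hπ H := Over.homMk (Spec.map (CommRingCat.ofHom ζ) ≫ j) (by
    rw [← Over.w (interQuotientMap hπ H), ← Category.assoc, hw, Over.w x])
  have hwx : w ≫ interQuotientMap hπ H = x := Over.OverMorphism.ext hw
  obtain ⟨z, hz⟩ := (exists_comp_openIncl_iff ((interQuotientMap hπ H).left ⁻¹ᵁ unramX π) w).mpr
    fun b => by
      change (interQuotientMap hπ H).left (w.left b) ∈ unramX π
      rw [← Scheme.Hom.comp_apply, ← Over.comp_left, hwx]
      exact hx b
  refine ⟨z, ?_⟩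
  rw [← hwx, ← hz, Category.assoc]
  rfl

end PointsInCharts

/-! ### Image, injectivity and surjectivity of `π_*` -/

section Main

variable {K : Type u} [Field K] {G : Type v} [Group G] [Finite G] {Y X : Over (base K)}
  {ρ : G →* Aut Y} {π : Y ⟶ X} {U : X.left.Opens} {x : pt K ⟶ X}
  {ψ : Γ(X.left, U) ⟶ CommRingCat.of K}

/-- An equivariant point of `Y°` has trivial inertia. -/
lemma IsQuotient.eq_one_of_sub_mem_ker (hπ : IsQuotient ρ π) (hY : IsVariety Y)
    (hρ : Function.Injective ρ) (hU : IsAffineOpen U) {L : LargeField.{u, v} G K}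
    {y : EquivariantPoint ρ L} (hyu : ∀ a, y.1.left a ∈ unramY π)
    {φ : Γ(Y.left, π.left ⁻¹ᵁ U) ⟶ CommRingCat.of L.carrier}
    (hφ : Spec.map φ ≫ (hπ.isAffineOpen_preimage hU).fromSpec = y.1.left) (g : G)
    (hg : letI := sectionsAction hπ.invariant U
      ∀ s, g • s - s ∈ RingHom.ker φ.hom) : g = 1 := by
  let a : Spec (.of L.carrier) := IsLocalRing.closedPoint L.carrier
  refine hπ.eq_one_of_inertia hY hρ hU (Spec.map φ a) ?_ g ?_
  · rw [← Scheme.Hom.comp_apply, hφ]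
    exact hyu a
  · rw [SpecMap_closedPoint_asIdeal]
    exact hg

/-- The image is in `X°` because an equivariant point is alone in its fibre; it avoids the images of
the `Y°/H` by the averaging argument of `eq_top_of_rational`. -/
theorem IsQuotient.pushforwardPoint_mem_primitivePoints [CharZero K] (hπ : IsQuotient ρ π)
    (hY : IsVariety Y) (hρ : Function.Injective ρ) {L : LargeField.{u, v} G K}
    (y : EquivariantPoint ρ L) (hyu : ∀ a, y.1.left a ∈ unramY π) :
    pushforwardPoint hπ.invariant L y ∈ primitivePoints hπ := by
  have hy := (pushforwardPoint_spec hπ.invariant L y).symm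
  refine ⟨(exists_comp_openIncl_iff _ _).mpr fun b => ?_, ?_⟩
  · let a : Spec (.of L.carrier) := IsLocalRing.closedPoint L.carrier
    rw [← left_apply_eq_of_comp_eq hy a b]
    exact hπ.mem_unramX_of_mem_unramY (hyu a) (hπ.eq_of_left_apply_eq y hy a)
  · simp only [Set.mem_iUnion, Set.mem_range, not_exists]
    intro H hH z hz
    obtain ⟨U, hU, ψ, hψ, hψs⟩ := exists_chart (pushforwardPoint hπ.invariant L y)
    let := sectionsAction hπ.invariant U
    let := sectionsAlgebra π U
    have := smulCommClass_sections hπ.invariant U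
    have := hπ.isInvariant_sections U
    obtain ⟨φ, hφ, h1, h2⟩ := hπ.exists_ringHom hU hψ y hy
    obtain ⟨ζ, hζ⟩ := hπ.exists_ringHom_invariantSections hU hψ H z hz
    exact hH.ne (eq_top_of_rational hψs h1 h2
      (hπ.eq_one_of_sub_mem_ker hY hρ hU hyu hφ) H (invariantSections ρ π H U)
      (mem_invariantSections_iff hπ.invariant H U) (app_mem hπ.invariant H U) ζ hζ)

/-- Equivariant points of `Y°` with the same image in `X(K)` are isomorphic. -/
theorem IsQuotient.exists_algEquiv (hπ : IsQuotient ρ π) (hY : IsVariety Y)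
    (hρ : Function.Injective ρ) {L L' : LargeField.{u, v} G K}
    {y : EquivariantPoint ρ L} (hyu : ∀ a, y.1.left a ∈ unramY π)
    {y' : EquivariantPoint ρ L'} (hyu' : ∀ a, y'.1.left a ∈ unramY π)
    (h : pushforwardPoint hπ.invariant L y = pushforwardPoint hπ.invariant L' y') :
    ∃ e : L.carrier ≃ₐ[K] L'.carrier,
      (∀ (g : G) a, e (L.iso.symm g a) = L'.iso.symm g (e a)) ∧
      Spec.map (CommRingCat.ofHom (e : L.carrier →+* L'.carrier)) ≫ y.1.left = y'.1.left := by
  have hy := (pushforwardPoint_spec hπ.invariant L y).symm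
  have hy' := (pushforwardPoint_spec hπ.invariant L' y').symm
  rw [← h] at hy'
  obtain ⟨U, hU, ψ, hψ, hψs⟩ := exists_chart (pushforwardPoint hπ.invariant L y)
  let := sectionsAction hπ.invariant U
  let := sectionsAlgebra π U
  have := smulCommClass_sections hπ.invariant U
  have := hπ.isInvariant_sections U
  obtain ⟨φ, hφ, h1, h2⟩ := hπ.exists_ringHom hU hψ y hy
  obtain ⟨φ', hφ', h1', h2'⟩ := hπ.exists_ringHom hU hψ y' hy'
  obtain ⟨e, he, heq⟩ := exists_algEquiv_of_equivariant hψs h1 h2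
    (surjective_of_equivariant hψs h1 h2 (hπ.eq_one_of_sub_mem_ker hY hρ hU hyu hφ)) h1' h2'
    (surjective_of_equivariant hψs h1' h2' (hπ.eq_one_of_sub_mem_ker hY hρ hU hyu' hφ'))
  refine ⟨e, heq, ?_⟩
  rw [← hφ, ← hφ', ← Spec.map_comp_assoc]
  congr 2
  exact CommRingCat.hom_ext (RingHom.ext he)

/-- Equivariant points of `Y°` with the same field and the same image in `X(K)` differ by an
element of the centre. -/
theorem IsQuotient.equiv_of_pushforwardPoint_eq (hπ : IsQuotient ρ π) (hY : IsVariety Y)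
    (hρ : Function.Injective ρ) {L : LargeField.{u, v} G K}
    {y : EquivariantPoint ρ L} (hyu : ∀ a, y.1.left a ∈ unramY π)
    {y' : EquivariantPoint ρ L} (hyu' : ∀ a, y'.1.left a ∈ unramY π)
    (h : pushforwardPoint hπ.invariant L y = pushforwardPoint hπ.invariant L y') : y ≈ y' := by
  obtain ⟨e, heq, he⟩ := hπ.exists_algEquiv hY hρ hyu hyu' h
  have hz : L.iso.symm (L.iso e)⁻¹⁻¹ = e := by rw [inv_inv, MulEquiv.symm_apply_apply]
  -- Since `z` acts on `Spec L` through `z⁻¹` on `L`, this is the element that acts as `Spec e`. It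
  -- is central because `e` commutes with `G`.
  refine ⟨(L.iso e)⁻¹, Subgroup.inv_mem _ (Subgroup.mem_center_iff.mpr fun g => ?_),
    Over.OverMorphism.ext ?_⟩
  · apply L.iso.symm.injective
    rw [map_mul, map_mul, MulEquiv.symm_apply_apply]
    ext a
    exact (heq g a).symm
  · change Spec.map (CommRingCat.ofHom (L.iso.symm (L.iso e)⁻¹⁻¹ : L.carrier →+* L.carrier)) ≫
      y.1.left = y'.1.left
    rw [hz, he]

/-- Every primitive point is the image of an equivariant point. -/
theorem IsQuotient.exists_equivariantPoint_of_mem_primitivePoints [CharZero K]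
    (hπ : IsQuotient ρ π) (hY : IsVariety Y) (hρ : Function.Injective ρ)
    (hx : x ∈ primitivePoints hπ) :
    ∃ (c : LargeFieldClass.{u, v} G K) (y : EquivariantPoint ρ c.out),
      y.1 ≫ π = toPt K c.out.carrier ≫ x := by
  obtain ⟨hx₁, hx₂⟩ := hx
  have hxX := (exists_comp_openIncl_iff _ _).mp hx₁
  obtain ⟨U, hU, ψ, hψ, hψs⟩ := exists_chart x
  let := sectionsAction hπ.invariant U
  let := sectionsAlgebra π U
  have := smulCommClass_sections hπ.invariant U
  have := hπ.isInvariant_sections U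
  obtain ⟨L, _, _, _, φ, τ, h1, h2⟩ := exists_equivariant (G := G) (ψ := ψ.hom)
    (S := Γ(Y.left, π.left ⁻¹ᵁ U)) hψs
    (fun p hp hpψ g hg => hπ.eq_one_of_inertia hY hρ hU ⟨p, hp⟩
      (mem_unramY_of_mem_unramX (by
        rw [(hπ.left_fromSpec_eq_iff hU hψ ⟨p, hp⟩ (IsLocalRing.closedPoint K)).mpr hpψ]
        exact hxX _)) g hg)
    (fun H A hA hRA ζ hζ => by
      obtain rfl : A = invariantSections ρ π H U :=
        Subring.ext fun s => (hA s).trans (mem_invariantSections_iff hπ.invariant H U s).symm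
      by_contra hH
      exact hx₂ (Set.mem_iUnion₂.mpr ⟨H, lt_top_iff_ne_top.mpr hH,
        hπ.exists_comp_unramInterQuotientMap hU hψ H hxX ζ hζ⟩))
    (hπ.injective U)
  let Λ : LargeField.{u, v} G K := { carrier := L, iso := τ.symm }
  -- The chosen representative of the class need not be `Λ` itself, so the point is transported
  -- along a `G`-equivariant isomorphism.
  obtain ⟨e, he⟩ : (Quotient.mk (largeFieldSetoid G K) Λ).out ≈ Λ := Quotient.mk_out Λ
  refine ⟨Quotient.mk _ Λ, hπ.exists_equivariantPoint hU hψ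
    (CommRingCat.ofHom ((e.symm : L →+* _).comp φ)) (fun r => ?_) fun g s => ?_⟩
  · refine (congrArg e.symm (h1 r)).trans ?_
    exact e.symm.commutes _
  · refine (congrArg e.symm (h2 g s)).trans ?_
    rw [AlgEquiv.symm_apply_eq, he]
    exact congrArg (τ g) (e.apply_symm_apply (φ s)).symm

end Main

end GaloisCover

end

theorem mainTheorem2 {K : Type u} [Field K] [NumberField K] {G : Type v} [Group G] [Finite G]
    {Y X : Over (GaloisCover.base K)} (hY : GaloisCover.IsVariety Y)
    (ρ : G →* Aut Y) (hρ : Function.Injective ρ)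
    (π : Y ⟶ X) (hπ : GaloisCover.IsQuotient ρ π) :
    Set.BijOn (GaloisCover.pushforward hπ)
      (GaloisCover.unramCurlyPoints ρ π) (GaloisCover.primitivePoints hπ) := by
  refine ⟨?_, ?_, ?_⟩
  · rintro _ ⟨c, y, hy, rfl⟩
    exact hπ.pushforwardPoint_mem_primitivePoints hY hρ y
      ((GaloisCover.exists_comp_openIncl_iff _ _).mp hy)
  · rintro _ ⟨c, y, hy, rfl⟩ _ ⟨c', y', hy', rfl⟩ h
    rw [GaloisCover.exists_comp_openIncl_iff] at hy hy'
    obtain ⟨e, he, -⟩ := hπ.exists_algEquiv hY hρ hy hy' h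
    -- The fields being equivariantly isomorphic, the classes coincide, and only the ambiguity by
    -- the centre remains.
    obtain rfl : c = c' := Quotient.out_equiv_out.mp ⟨e, he⟩
    exact congrArg (Sigma.mk c) (Quotient.sound (hπ.equiv_of_pushforwardPoint_eq hY hρ hy hy' h))
  · intro x hx
    obtain ⟨c, y, hy⟩ := hπ.exists_equivariantPoint_of_mem_primitivePoints hY hρ hx
    refine ⟨⟨c, Quotient.mk _ y⟩, ⟨c, y, (GaloisCover.exists_comp_openIncl_iff _ _).mpr fun a => ?_,
      rfl⟩, ?_⟩
    · apply GaloisCover.mem_unramY_of_mem_unramX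
      rw [GaloisCover.left_apply_eq_of_comp_eq hy a (IsLocalRing.closedPoint K)]
      exact (GaloisCover.exists_comp_openIncl_iff _ _).mp hx.1 _
    · apply GaloisCover.toPt_cancel (L := c.out.carrier)
      exact (GaloisCover.pushforwardPoint_spec hπ.invariant c.out y).trans hy
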